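/- **Setup.** For nonnegative integers $a,b,c$ let $H(a,b,c)$ be the hexagon on the triangular lattice (with horizontal lattice lines) all of whose angles are $120^\circ$ and whose side lengths, counterclockwise from the bottom horizontal side, are $b,a,c,b,a,c$. A *lozenge* is the union of two unit triangles sharing an edge, and a *lozenge tiling* of a region is a covering of it by non-overlapping lozenges contained in it. At a corner where sides of lengths $p$ and $q$ meet, put $m=\min(p,q)$; the *maximal staircase* at this corner consists of $m(m-1)/2$ lozenges with sides parallel to these two sides, packed into the corner in rows of lengths $m-1,m-2,\dots,1$. Let $H_{\rm d}(a,b,c)$ be the region obtained from $H(a,b,c)$ by removing the maximal staircases at the northwestern corner (where the top side, of length $b$, and the upper left side, of length $a$, meet) and at the eastern corner (where the lower right side, of length $a$, and the upper right side, of length $c$, meet). Along the zig-zag cut that removed the northwestern staircase there are $\min(a,b)$ lozenge positions fitting in its indentations (the positions which would extend the rows of that staircase to lengths $m,m-1,\dots,1$, $m=\min(a,b)$). Let $$L^*(H_{\rm d}(a,b,c))=\sum_T 2^{-k(T)},$$ where $T$ runs over all lozenge tilings of $H_{\rm d}(a,b,c)$ and $k(T)$ is the number of lozenges of $T$ occupying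 one of these positions. (No weights are placed along the eastern cut.) **Proposition.** If $a\le b\le c$, then $$L^*(H_{\rm d}(a,b,c))=\frac{1}{2^a}\prod_{j=1}^{a}\frac{(j-1)!\,(b+2c-3a+3j)\,(b+c-2a+j)!}{(c-a+2j-1)!}\cdot\frac{(b+2c-3a+2j+1)_{j-1}\,(2b+c-3a+2j+1)_{j-1}}{(b-a+2j-1)!},$$ where $(\alpha)_k=\alpha(\alpha+1)\cdots(\alpha+k-1)$ for $k\ge1$ and $(\alpha)_0=1$. -/

import Mathlib

namespace TriLattice

/-- A unit triangle of the triangular lattice.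

The lattice point `(x, y) : ℤ × ℤ` stands for the point `x • e₁ + y • e₂` of the plane, where
`e₁ = (1, 0)` and `e₂ = (1/2, √3/2)`.  So the lattice lines have the directions `e₁` (horizontal),
`e₂` (going up to the right) and `e₂ - e₁` (going up to the left).

The upward-pointing triangle with parameters `x, y` has the corners
`(x, y)`, `(x + 1, y)`, `(x, y + 1)`; the downward-pointing one has the corners
`(x + 1, y)`, `(x, y + 1)`, `(x + 1, y + 1)`.  -/
structure UnitTriangle where
  x : ℤ
  y : ℤ
  pointsUp : Bool
deriving DecidableEq

/-- The three corners of a unit triangle. -/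
def UnitTriangle.corners (t : UnitTriangle) : Finset (ℤ × ℤ) :=
  if t.pointsUp then {(t.x, t.y), (t.x + 1, t.y), (t.x, t.y + 1)}
  else {(t.x + 1, t.y), (t.x, t.y + 1), (t.x + 1, t.y + 1)}

/-- A region on the triangular lattice: a finite set of unit triangles. -/
abbrev Region : Type := Finset UnitTriangle

/-- A lozenge: the union of two unit triangles that share an edge, that is, that have exactly two
corners in common. -/
def IsLozenge (l : Region) : Prop :=
  ∃ s t : UnitTriangle, (s.corners ∩ t.corners).card = 2 ∧ l = {s, t}

/-- `T` is a lozenge tiling of `R`: a family of lozenges, no two of which overlap, whose union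
is `R`. -/
def IsLozengeTiling (R : Region) (T : Finset Region) : Prop :=
  (∀ l ∈ T, IsLozenge l) ∧
    (T : Set Region).PairwiseDisjoint id ∧
    T.biUnion id = R

open Classical in
/-- The finite set of all lozenge tilings of `R` (see `mem_tilings`). -/
noncomputable def tilings (R : Region) : Finset (Finset Region) :=
  R.powerset.powerset.filter (IsLozengeTiling R)

theorem mem_tilings {R : Region} {T : Finset Region} : T ∈ tilings R ↔ IsLozengeTiling R T := by
  classical
  unfold tilings
  rw [Finset.mem_filter]
  refine ⟨fun h => h.2, fun h => ⟨?_, h⟩⟩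
  rw [Finset.mem_powerset]
  intro l hl
  rw [Finset.mem_powerset, ← h.2.2]
  exact Finset.subset_biUnion_of_mem id hl

/-- The weighted tiling enumerator of `R` in which the tile positions in `M` are weighted by `1/2`:
a tiling using exactly `k` lozenges from `M` has weight `1 / 2 ^ k`. -/
noncomputable def weightedCount (R : Region) (M : Finset Region) : ℚ :=
  ∑ T ∈ tilings R, (1 / 2 : ℚ) ^ (T ∩ M).card

/-- The lattice point `p` lies in the closed hexagon with the consecutive (counterclockwise)
vertices `(0, 0)`, `(b, 0)`, `(b, a)`, `(b - c, a + c)`, `(-c, a + c)`, `(-c, c)`.  Starting from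
the bottom edge and moving counterclockwise, its side lengths are `b, a, c, b, a, c`. -/
def InHexagon (a b c : ℕ) (p : ℤ × ℤ) : Prop :=
  0 ≤ p.2 ∧ p.2 ≤ (a : ℤ) + c ∧
  -(c : ℤ) ≤ p.1 ∧ p.1 ≤ (b : ℤ) ∧
  0 ≤ p.1 + p.2 ∧ p.1 + p.2 ≤ (a : ℤ) + b

open Classical in
/-- The hexagon `H(a, b, c)`, with horizontal sides of length `b`, the other two pairs of parallel
sides having, counterclockwise, lengths `a` and `c` : all unit triangles contained in the hexagon
described by `InHexagon` (see `mem_hexagon`). -/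
noncomputable def hexagon (a b c : ℕ) : Region :=
  ((Finset.Icc (-(c : ℤ) - 1) b ×ˢ Finset.Icc (-1 : ℤ) ((a : ℤ) + c) ×ˢ
      (Finset.univ : Finset Bool)).image
        fun q => (⟨q.1, q.2.1, q.2.2⟩ : UnitTriangle)).filter
    fun t => ∀ p ∈ t.corners, InHexagon a b c p

theorem mem_hexagon {a b c : ℕ} {t : UnitTriangle} :
    t ∈ hexagon a b c ↔ ∀ p ∈ t.corners, InHexagon a b c p := by
  classical
  unfold hexagon
  rw [Finset.mem_filter]
  refine ⟨fun h => h.2, fun h => ⟨?_, h⟩⟩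
  rw [Finset.mem_image]
  refine ⟨(t.x, t.y, t.pointsUp), ?_, rfl⟩
  obtain ⟨x, y, u⟩ := t
  have h1 := h (x + 1, y) (by cases u <;> simp [UnitTriangle.corners])
  have h2 := h (x, y + 1) (by cases u <;> simp [UnitTriangle.corners])
  simp only [InHexagon] at h1 h2
  simp only [Finset.mem_product, Finset.mem_Icc, Finset.mem_univ, and_true]
  omega

/-- Rhombi with sides parallel to the two sides (the top one, and the upper left one) that meet in
the northwestern corner `(-c, a + c)` of `H(a, b, c)`.  `nwRhombus a c 0 0` is the one fitting in
that corner; `nwRhombus a c k l` is obtained from it by moving `k` units along the top side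
(to the right) and `l` units along the upper left side (down to the left). -/
def nwRhombus (a c k l : ℕ) : Region :=
  {⟨-(c : ℤ) + k, (a : ℤ) + c - 1 - l, true⟩, ⟨-(c : ℤ) + k, (a : ℤ) + c - 1 - l, false⟩}

/-- Rhombi with sides parallel to the two sides (the lower right one, and the upper right one) that
meet in the eastern corner `(b, a)` of `H(a, b, c)`.  `eastRhombus a b 0 0` is the one fitting in
that corner; `eastRhombus a b k l` is obtained from it by moving `k` units along the lower right
side (down to the left) and `l` units along the upper right side (up to the left). -/
def eastRhombus (a b k l : ℕ) : Region :=
  {⟨(b : ℤ) - 1 - l, (a : ℤ) - k + l, true⟩, ⟨(b : ℤ) - 1 - l, (a : ℤ) - k + l - 1, false⟩}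

/-- The maximal staircase of lozenges in the northwestern corner of `H(a, b, c)`, where sides of
lengths `a` and `b` meet: with `m = min a b`, its rows have `m - 1, m - 2, …, 1, 0` lozenges. -/
def nwStaircase (a b c : ℕ) : Region :=
  ((Finset.range (min a b) ×ˢ Finset.range (min a b)).filter
    fun q => q.1 + q.2 + 1 < min a b).biUnion fun q => nwRhombus a c q.1 q.2

/-- The maximal staircase of lozenges in the eastern corner of `H(a, b, c)`, where sides of
lengths `a` and `c` meet: with `m = min a c`, its rows have `m - 1, m - 2, …, 1, 0` lozenges. -/
def eastStaircase (a b c : ℕ) : Region :=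
  ((Finset.range (min a c) ×ˢ Finset.range (min a c)).filter
    fun q => q.1 + q.2 + 1 < min a c).biUnion fun q => eastRhombus a b q.1 q.2

/-- The region `H_d(a, b, c)`: the hexagon `H(a, b, c)` with the maximal staircases removed from
its northwestern and eastern corners. -/
noncomputable def cutHexagon (a b c : ℕ) : Region :=
  hexagon a b c \ (nwStaircase a b c ∪ eastStaircase a b c)

/-- The `min a b` tile positions that fit in the indentations of the zig-zag cut that removed the
northwestern staircase. -/
def nwCutPositions (a b c : ℕ) : Finset Region :=
  ((Finset.range (min a b) ×ˢ Finset.range (min a b)).filter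
    fun q => q.1 + q.2 + 1 = min a b).image fun q => nwRhombus a c q.1 q.2

/-- The weighted enumerator `L^*(H_d(a, b, c))`: only the tile positions along the northwestern
cut are weighted by `1/2`. -/
noncomputable def upperStarCount (a b c : ℕ) : ℚ :=
  weightedCount (cutHexagon a b c) (nwCutPositions a b c)

end TriLattice

/-! ### The Desnanot–Jacobi identity -/

section DesnanotJacobi

open Matrix

variable {R : Type*} [CommRing R]

/-! The weighted count is turned into a determinant by non-intersecting lattice paths, and the
determinant is evaluated by condensation.

The removed staircases are put back: the sum runs over tilings of the full hexagon, but certain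
lozenges overlapping the staircases get weight `0`. The only surviving tilings contain both
staircases in their standard tiling, so the sum is unchanged (`upperStarCount_eq_tilingSum`).

In the full hexagon, lozenges of two of the three kinds form `a` lattice paths from the upper left
side (abscissa `-c`, ordinates `c + i`) to the lower right side (abscissa `b`, ordinates `j`); each
step keeps the ordinate or lowers it by one. Lozenges of the third kind avoid the paths and have
weight `1`. Sweeping the hexagon strip by strip gives the determinant of the path sums
(`tilingSum_hexagon`).

The zero weights make the path from `c + i` start with `i` level steps and the path to `j` end with
`j` descending steps. In between it crosses the cut, with a level step of weight `1/2` or a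
descending one of weight `1`, and is free afterwards. The two cases combine to `(β + 2γ)/2 * p!/(β!
γ!)`, where `β + 2γ` depends on the end point only. Pulling these factors out of the columns and
reversing the indices leaves `factorialMatrix` (`upperStarCount_eq_det`).

Its contiguous minors are again factorial matrices, so Desnanot–Jacobi determines the determinant by
induction on the size, and the product formula satisfies the same recursion (`det_factorialMatrix`).
-/

theorem det_updateCol_updateCol_one {n : Type*} [Fintype n] [DecidableEq n] {i j : n}
    (hij : i ≠ j) (u v : n → R) :
    (((1 : Matrix n n R).updateCol i u).updateCol j v).det = u i * v j - v i * u j := by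
  -- The matrix is a rank-two perturbation of the identity, so Sylvester's identity reduces its
  -- determinant to a 2 × 2 one.
  have h : ((1 : Matrix n n R).updateCol i u).updateCol j v =
      1 + (Matrix.of fun k (s : Fin 2) =>
        if s = 0 then u k - (1 : Matrix n n R) k i else v k - (1 : Matrix n n R) k j) *
        (Matrix.of fun (s : Fin 2) k =>
          if s = 0 then (1 : Matrix n n R) i k else (1 : Matrix n n R) j k) := by
    ext k l
    rw [Matrix.add_apply, Matrix.mul_apply, Fin.sum_univ_two]
    by_cases h1 : l = j
    · subst h1
      simp [hij]
    · by_cases h2 : l = i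
      · subst h2
        simp [h1, Ne.symm h1]
      · simp [h1, h2, Ne.symm h1, Ne.symm h2]
  rw [h, Matrix.det_one_add_mul_comm, Matrix.det_fin_two]
  simp [Matrix.mul_apply, Matrix.one_apply, hij, hij.symm]

/-- The Desnanot–Jacobi identity in terms of the adjugate, up to a factor `det A`. -/
theorem det_mul_adjugate_minor {n : ℕ} (A : Matrix (Fin (n + 2)) (Fin (n + 2)) R) :
    A.det * (A.adjugate 0 0 * A.adjugate (Fin.last _) (Fin.last _) -
        A.adjugate 0 (Fin.last _) * A.adjugate (Fin.last _) 0) =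
      A.det * (A.det * (A.submatrix (fun i : Fin n => i.castSucc.succ)
        (fun i : Fin n => i.castSucc.succ)).det) := by
  have hne : (0 : Fin (n + 2)) ≠ Fin.last (n + 1) := (Fin.last_pos).ne
  rw [← det_updateCol_updateCol_one hne (fun k => A.adjugate k 0)
    (fun k => A.adjugate k (Fin.last _)), ← Matrix.det_mul]
  -- By `A * adj A = det A`, the outer columns of `C` are `det A` times the first and the last unit
  -- vector, while the inner columns are those of `A`. Expanding along the outer columns gives `det
  -- A ^ 2` times the central minor.
  set C := A * ((1 : Matrix (Fin (n + 2)) (Fin (n + 2)) R).updateCol 0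
    fun k => A.adjugate k 0).updateCol (Fin.last _) fun k => A.adjugate k (Fin.last _) with hC
  have hadj : ∀ k l, ∑ x, A k x * A.adjugate x l = if k = l then A.det else 0 := by
    intro k l
    rw [← Matrix.mul_apply, Matrix.mul_adjugate]
    simp [Matrix.one_apply]
  have h0 : ∀ k, C k 0 = if k = 0 then A.det else 0 := by
    intro k
    rw [← hadj, hC, Matrix.mul_apply]
    refine Finset.sum_congr rfl fun x _ => ?_
    rw [Matrix.updateCol_ne hne, Matrix.updateCol_self]
  have h1 : ∀ k, C k (Fin.last _) = if k = Fin.last _ then A.det else 0 := by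
    intro k
    rw [← hadj, hC, Matrix.mul_apply]
    refine Finset.sum_congr rfl fun x _ => ?_
    rw [Matrix.updateCol_self]
  have h2 : ∀ k (l : Fin n), C k l.castSucc.succ = A k l.castSucc.succ := by
    intro k l
    have hl : l.castSucc.succ ≠ Fin.last (n + 1) := by
      rw [Fin.succ_castSucc]; exact (Fin.castSucc_lt_last _).ne
    rw [hC, Matrix.mul_apply, Finset.sum_eq_single l.castSucc.succ]
    · rw [Matrix.updateCol_ne hl, Matrix.updateCol_ne (Fin.succ_ne_zero _)]
      simp
    · intro x _ hx
      rw [Matrix.updateCol_ne hl, Matrix.updateCol_ne (Fin.succ_ne_zero _)]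
      simp [hx]
    · simp
  rw [Matrix.det_succ_column_zero,
    Finset.sum_eq_single 0 (fun b _ hb => by simp [h0, hb]) (by simp),
    Matrix.det_succ_column _ (Fin.last n),
    Finset.sum_eq_single (Fin.last n)]
  · have h3 : (C.submatrix (Fin.succAbove 0) Fin.succ) (Fin.last n) (Fin.last n) = A.det := by
      simp [h1, Matrix.submatrix_apply]
    rw [h3, h0]
    have h4 : ((C.submatrix (Fin.succAbove 0) Fin.succ).submatrix (Fin.last n).succAbove
        (Fin.last n).succAbove) = A.submatrix (fun i : Fin n => i.castSucc.succ)
        (fun i : Fin n => i.castSucc.succ) := by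
      ext i j
      simp only [Matrix.submatrix_apply, Fin.succAbove_last, Fin.zero_succAbove]
      exact h2 _ _
    rw [h4]
    simp [← two_mul]
  · intro b _ hb
    have : (C.submatrix (Fin.succAbove 0) Fin.succ) b (Fin.last n) = 0 := by
      simp only [Matrix.submatrix_apply, Fin.zero_succAbove, Fin.succ_last, h1]
      rw [if_neg]
      intro h
      exact hb (Fin.succ_injective _ (by rw [h, Fin.succ_last]))
    rw [this]; simp
  · simp

/-- The Desnanot–Jacobi identity. -/
theorem desnanot_jacobi {n : ℕ} (A : Matrix (Fin (n + 2)) (Fin (n + 2)) R) :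
    A.det * (A.submatrix (fun i : Fin n => i.castSucc.succ)
        (fun i : Fin n => i.castSucc.succ)).det =
      (A.submatrix Fin.succ Fin.succ).det * (A.submatrix Fin.castSucc Fin.castSucc).det -
        (A.submatrix Fin.succ Fin.castSucc).det * (A.submatrix Fin.castSucc Fin.succ).det := by
  have adj : A.adjugate 0 0 * A.adjugate (Fin.last _) (Fin.last _) -
        A.adjugate 0 (Fin.last _) * A.adjugate (Fin.last _) 0 =
      A.det * (A.submatrix (fun i : Fin n => i.castSucc.succ)
        (fun i : Fin n => i.castSucc.succ)).det := by
    -- The factor `det A` may be a zero divisor in `R`. It is cancelled for the matrix of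
    -- indeterminates over `ℤ`, whose determinant is nonzero, and the result is specialised to `A`.
    let G := mvPolynomialX (Fin (n + 2)) (Fin (n + 2)) ℤ
    have hG := mul_left_cancel₀ (det_mvPolynomialX_ne_zero (Fin (n + 2)) ℤ)
      (det_mul_adjugate_minor G)
    let φ : MvPolynomial (Fin (n + 2) × Fin (n + 2)) ℤ →+* R :=
      MvPolynomial.eval₂Hom (Int.castRingHom R) fun p => A p.1 p.2
    have hφ : φ.mapMatrix G = A := by
      ext i j
      simp [φ, G]
    have key := congrArg φ hG
    rw [map_sub, map_mul, map_mul, map_mul, RingHom.map_det, RingHom.map_det] at key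
    have hadj : ∀ i j, φ (G.adjugate i j) = A.adjugate i j := by
      intro i j
      rw [← hφ, ← RingHom.map_adjugate]
      rfl
    have hsub : φ.mapMatrix (G.submatrix (fun i : Fin n => i.castSucc.succ)
        (fun i : Fin n => i.castSucc.succ)) = A.submatrix (fun i : Fin n => i.castSucc.succ)
        (fun i : Fin n => i.castSucc.succ) := by
      rw [← hφ]; rfl
    rw [hsub, hφ] at key
    simpa only [hadj] using key
  rw [← adj]
  simp only [adjugate_fin_succ_eq_det_submatrix, Fin.succAbove_last, Fin.succAbove_zero]
  have hs : ((-1 : R) ^ (n + 1)) * (-1) ^ (n + 1) = 1 := by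
    rw [← mul_pow]; simp
  simp only [Fin.val_zero, Fin.val_last, add_zero, zero_add, pow_add _ (n + 1), pow_zero, one_mul]
  linear_combination ((A.submatrix Fin.succ Fin.succ).det *
    (A.submatrix Fin.castSucc Fin.castSucc).det -
    (A.submatrix Fin.succ Fin.castSucc).det * (A.submatrix Fin.castSucc Fin.succ).det) * hs

end DesnanotJacobi

/-! ### Evaluation of the factorial determinant by condensation -/

section FactorialDeterminant

open Matrix
open scoped Nat

/-- The reciprocal of `z!`, which vanishes at the negative integers. -/
def invFactorial (z : ℤ) : ℚ := if z < 0 then 0 else ((z.toNat)! : ℚ)⁻¹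

theorem invFactorial_of_neg {z : ℤ} (h : z < 0) : invFactorial z = 0 := if_pos h

@[simp]
theorem invFactorial_natCast (n : ℕ) : invFactorial n = (n ! : ℚ)⁻¹ := by
  simp [invFactorial]

/-- The matrix of `(p + i + j)! / ((x + 2 i - j)! (y + 2 j - i)!)`. -/
def factorialMatrix (n p : ℕ) (x y : ℤ) : Matrix (Fin n) (Fin n) ℚ :=
  Matrix.of fun i j => ((p + i + j)! : ℚ) * invFactorial (x + 2 * (i : ℤ) - (j : ℤ)) *
    invFactorial (y + 2 * (j : ℤ) - (i : ℤ))

/-- The product formula for the determinant of `factorialMatrix`. -/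
noncomputable def factorialProduct (n p x y : ℕ) : ℚ :=
  ∏ i ∈ Finset.range n, ((i ! : ℚ) * (p + i)! *
    (ascPochhammer ℚ i).eval (2 * (x : ℚ) + y + 2 * i) *
    (ascPochhammer ℚ i).eval ((x : ℚ) + 2 * y + 2 * i) / ((x + 2 * i)! * (y + 2 * i)!))

theorem factorialMatrix_eq {n m p q : ℕ} {x y x' y' : ℤ} {f g : Fin m → Fin n}
    (h1 : ∀ i j, p + f i + g j = q + i + j)
    (h2 : ∀ i j, x + 2 * ((f i : ℕ) : ℤ) - ((g j : ℕ) : ℤ) = x' + 2 * (i : ℤ) - (j : ℤ))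
    (h3 : ∀ i j, y + 2 * ((g j : ℕ) : ℤ) - ((f i : ℕ) : ℤ) = y' + 2 * (j : ℤ) - (i : ℤ)) :
    (factorialMatrix n p x y).submatrix f g = factorialMatrix m q x' y' := by
  ext i j
  simp only [factorialMatrix, Matrix.submatrix_apply, Matrix.of_apply, h1, h2, h3]

/-- Deleting an initial row or column only shifts the parameters, so all five minors are factorial
matrices. Each shift preserves `x + y - p`, and hence the relation `x + y = p + 1` needed for the
evaluation. -/
theorem det_factorialMatrix_condensation (n p : ℕ) (x y : ℤ) :
    (factorialMatrix (n + 2) p x y).det * (factorialMatrix n (p + 2) (x + 1) (y + 1)).det =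
      (factorialMatrix (n + 1) (p + 2) (x + 1) (y + 1)).det * (factorialMatrix (n + 1) p x y).det -
        (factorialMatrix (n + 1) (p + 1) (x + 2) (y - 1)).det *
          (factorialMatrix (n + 1) (p + 1) (x - 1) (y + 2)).det := by
  have h := desnanot_jacobi (factorialMatrix (n + 2) p x y)
  rwa [factorialMatrix_eq (q := p + 2) (x' := x + 1) (y' := y + 1),
    factorialMatrix_eq (q := p + 2) (x' := x + 1) (y' := y + 1),
    factorialMatrix_eq (q := p) (x' := x) (y' := y),
    factorialMatrix_eq (q := p + 1) (x' := x + 2) (y' := y - 1),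
    factorialMatrix_eq (q := p + 1) (x' := x - 1) (y' := y + 2)] at h
  all_goals
    intro i j
    simp only [Fin.val_succ, Fin.val_castSucc] <;> omega

theorem det_factorialMatrix_neg_one_left (n p : ℕ) (y : ℤ) :
    (factorialMatrix (n + 1) p (-1) y).det = 0 := by
  refine Matrix.det_eq_zero_of_row_eq_zero 0 fun j => ?_
  rw [factorialMatrix, Matrix.of_apply, invFactorial_of_neg]
  · simp
  · simp only [Fin.val_zero]; omega

theorem det_factorialMatrix_neg_one_right (n p : ℕ) (x : ℤ) :
    (factorialMatrix (n + 1) p x (-1)).det = 0 := by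
  refine Matrix.det_eq_zero_of_column_eq_zero 0 fun j => ?_
  rw [factorialMatrix, Matrix.of_apply, invFactorial_of_neg (z := -1 + _ - _)]
  · simp
  · simp only [Fin.val_zero]; omega

theorem factorialProduct_pos (n p x y : ℕ) (h : 0 < x + y) : 0 < factorialProduct n p x y := by
  have h' : (0 : ℚ) < x + y := by exact_mod_cast h
  refine Finset.prod_pos fun i _ => ?_
  have h1 : 0 < (ascPochhammer ℚ i).eval (2 * (x : ℚ) + y + 2 * i) :=
    ascPochhammer_pos _ _ (by
      linarith [(Nat.cast_nonneg x : (0 : ℚ) ≤ x), (Nat.cast_nonneg i : (0 : ℚ) ≤ i)])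
  have h2 : 0 < (ascPochhammer ℚ i).eval ((x : ℚ) + 2 * y + 2 * i) :=
    ascPochhammer_pos _ _ (by
      linarith [(Nat.cast_nonneg y : (0 : ℚ) ≤ y), (Nat.cast_nonneg i : (0 : ℚ) ≤ i)])
  positivity

/-- `factorialProduct` as a quotient of products over the individual kinds of factors. -/
theorem factorialProduct_eq (n p x y : ℕ) :
    factorialProduct n p x y = (∏ i ∈ Finset.range n, (i ! : ℚ)) *
      (∏ i ∈ Finset.range n, ((p + i)! : ℚ)) *
      (∏ i ∈ Finset.range n, (ascPochhammer ℚ i).eval (2 * (x : ℚ) + y + 2 * i)) *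
      (∏ i ∈ Finset.range n, (ascPochhammer ℚ i).eval ((x : ℚ) + 2 * y + 2 * i)) /
      ((∏ i ∈ Finset.range n, ((x + 2 * i)! : ℚ)) * ∏ i ∈ Finset.range n, ((y + 2 * i)! : ℚ)) := by
  simp only [factorialProduct, Finset.prod_div_distrib, Finset.prod_mul_distrib]

theorem prod_factorial_shift_one (n p : ℕ) :
    (∏ i ∈ Finset.range n, ((p + 1 + i)! : ℚ)) * p ! =
      (∏ i ∈ Finset.range n, ((p + i)! : ℚ)) * (p + n)! := by
  rw [← Finset.prod_range_succ, Finset.prod_range_succ']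
  simp only [add_assoc, add_comm 1, add_zero]

theorem prod_factorial_shift_two (n x : ℕ) :
    (∏ i ∈ Finset.range n, ((x + 2 + 2 * i)! : ℚ)) * x ! =
      (∏ i ∈ Finset.range n, ((x + 2 * i)! : ℚ)) * (x + 2 * n)! := by
  rw [← Finset.prod_range_succ, Finset.prod_range_succ']
  simp only [mul_add, add_assoc, add_comm 2, mul_one, mul_zero, add_zero]

/-- The first factor of the longer Pochhammer symbol is split off; the others match because the
argument moves by `3` when `x` and `y` both grow by `1`. -/
theorem prod_ascPochhammer_shift (n : ℕ) (s : ℚ) :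
    (ascPochhammer ℚ (n + 1)).eval (s + 2 * (n + 1 : ℕ)) =
      (ascPochhammer ℚ n).eval (s + 3 + 2 * n) * (s + 2 * n + 2) := by
  rw [ascPochhammer_succ_left, Polynomial.eval_mul, Polynomial.eval_comp]
  simp only [Polynomial.eval_X, Polynomial.eval_add, Polynomial.eval_one]
  push_cast
  ring_nf

/-- The ratio of the two products in the condensation identity that keep `2 x + y` and
`x + 2 y` balanced. -/
theorem factorialProduct_mul (n p x y : ℕ) (h : x + y = p + 1) :
    factorialProduct (n + 2) p x y * factorialProduct n (p + 2) (x + 1) (y + 1) *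
      ((x + y + n + 1) * (x + 2 * n + 2) * (y + 2 * n + 2)) =
    factorialProduct (n + 1) (p + 2) (x + 1) (y + 1) * factorialProduct (n + 1) p x y *
      ((n + 1) * (2 * x + y + 2 * n + 2) * (x + 2 * y + 2 * n + 2)) := by
  have hp : (x : ℚ) + y = p + 1 := by exact_mod_cast h
  have e1 : (2 * ((x + 1 : ℕ) : ℚ) + (y + 1 : ℕ)) = 2 * x + y + 3 := by push_cast; ring
  have e2 : (((x + 1 : ℕ) : ℚ) + 2 * (y + 1 : ℕ)) = x + 2 * y + 3 := by push_cast; ring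
  -- Splitting the last factor off `factorialProduct (n + 2) p x y` and off `factorialProduct (n +
  -- 1) (p + 2) (x + 1) (y + 1)` leaves the same products on both sides, so only these two factors
  -- are compared.
  rw [factorialProduct, Finset.prod_range_succ, ← factorialProduct,
    factorialProduct.eq_1 (n + 1) (p + 2), Finset.prod_range_succ, ← factorialProduct, e1, e2]
  simp only [prod_ascPochhammer_shift]
  have f1 : ((p + (n + 1))! : ℚ) * (x + y + n + 1) = (p + 2 + n)! := by
    rw [show p + 2 + n = (p + (n + 1)) + 1 by ring, Nat.factorial_succ (p + (n + 1))]
    push_cast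
    rw [hp]
    ring
  have f2 : ∀ x : ℕ, ((x + 2 * (n + 1))! : ℚ) = (x + 1 + 2 * n)! * (x + 2 * n + 2) := by
    intro x
    rw [show x + 2 * (n + 1) = (x + 1 + 2 * n) + 1 by ring, Nat.factorial_succ]
    push_cast
    ring
  have f3 : ((n + 1)! : ℚ) = (n + 1) * n ! := by
    rw [Nat.factorial_succ]; push_cast; ring
  rw [f2 x, f2 y, f3, ← f1]
  field_simp

theorem prod_factorial_shift_one_sq (n p : ℕ) :
    (∏ i ∈ Finset.range n, ((p + 1 + i)! : ℚ)) ^ 2 * (p + 1 + n) =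
      (∏ i ∈ Finset.range n, ((p + 2 + i)! : ℚ)) * (∏ i ∈ Finset.range n, ((p + i)! : ℚ)) *
        (p + 1) := by
  have h1 := prod_factorial_shift_one n p
  have h2 := prod_factorial_shift_one n (p + 1)
  rw [show p + 1 + n = (p + n) + 1 by ring, Nat.factorial_succ, Nat.factorial_succ] at h2
  push_cast at h2
  have hp : (p ! : ℚ) * (p + n)! ≠ 0 := by positivity
  refine mul_right_cancel₀ hp ?_
  simp only [add_assoc, one_add_one_eq_two] at h1 h2 ⊢
  linear_combination (∏ i ∈ Finset.range n, ((p + (1 + i))! : ℚ)) * (p + n)! * (p + 1 + n) * h1 -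
    (∏ i ∈ Finset.range n, ((p + i)! : ℚ)) * (p + n)! * h2

theorem prod_factorial_shift_three (n x : ℕ) :
    (∏ i ∈ Finset.range n, ((x + 3 + 2 * i)! : ℚ)) * (∏ i ∈ Finset.range n, ((x + 2 * i)! : ℚ)) *
        (x + 1) =
      (∏ i ∈ Finset.range n, ((x + 2 + 2 * i)! : ℚ)) *
        (∏ i ∈ Finset.range n, ((x + 1 + 2 * i)! : ℚ)) * (x + 1 + 2 * n) := by
  have h1 := prod_factorial_shift_two n x
  have h2 := prod_factorial_shift_two n (x + 1)
  rw [show x + 1 + 2 * n = (x + 2 * n) + 1 by ring, Nat.factorial_succ, Nat.factorial_succ,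
    show x + 1 + 2 = x + 3 by ring] at h2
  push_cast at h2
  have hp : (x ! : ℚ) * (x + 2 * n)! ≠ 0 := by positivity
  refine mul_right_cancel₀ hp ?_
  linear_combination (∏ i ∈ Finset.range n, ((x + 2 * i)! : ℚ)) * (x + 2 * n)! * h2 -
    (∏ i ∈ Finset.range n, ((x + 1 + 2 * i)! : ℚ)) * (x + 2 * n)! * (x + 1 + 2 * n) * h1

/-- The arguments `2x + y` and `x + 2y` are raised by `3` once and by `6` once on either side, so
all Pochhammer symbols cancel. Only factorials remain, and their products telescope. -/
theorem factorialProduct_mul_shift (n p x y : ℕ) :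
    factorialProduct n (p + 2) (x + 3) y * factorialProduct n (p + 2) x (y + 3) *
      ((p + 2 + n) * (x + 1 + 2 * n) * (y + 1 + 2 * n)) =
    factorialProduct n (p + 3) (x + 2) (y + 2) * factorialProduct n (p + 1) (x + 1) (y + 1) *
      ((p + 2) * (x + 1) * (y + 1)) := by
  have h1 := prod_factorial_shift_one_sq n (p + 1)
  have h2 := prod_factorial_shift_three n x
  have h3 := prod_factorial_shift_three n y
  simp only [factorialProduct_eq]
  have e1 : 2 * ((x + 3 : ℕ) : ℚ) + y = 2 * x + y + 6 := by push_cast; ring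
  have e2 : ((x + 3 : ℕ) : ℚ) + 2 * y = x + 2 * y + 3 := by push_cast; ring
  have e3 : 2 * (x : ℚ) + (y + 3 : ℕ) = 2 * x + y + 3 := by push_cast; ring
  have e4 : (x : ℚ) + 2 * (y + 3 : ℕ) = x + 2 * y + 6 := by push_cast; ring
  have e5 : 2 * ((x + 2 : ℕ) : ℚ) + (y + 2 : ℕ) = 2 * x + y + 6 := by push_cast; ring
  have e6 : ((x + 2 : ℕ) : ℚ) + 2 * (y + 2 : ℕ) = x + 2 * y + 6 := by push_cast; ring
  have e7 : 2 * ((x + 1 : ℕ) : ℚ) + (y + 1 : ℕ) = 2 * x + y + 3 := by push_cast; ring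
  have e8 : ((x + 1 : ℕ) : ℚ) + 2 * (y + 1 : ℕ) = x + 2 * y + 3 := by push_cast; ring
  rw [e1, e2, e3, e4, e5, e6, e7, e8]
  simp only [show p + 1 + 1 = p + 2 by ring, show p + 1 + 2 = p + 3 by ring] at h1
  push_cast at h1
  have pos : ∀ q k : ℕ, (∏ i ∈ Finset.range n, ((q + k * i)! : ℚ)) ≠ 0 := fun q k =>
    Finset.prod_ne_zero_iff.2 fun i _ => by positivity
  have := pos x 2
  have := pos (x + 1) 2
  have := pos (x + 2) 2
  have := pos (x + 3) 2
  have := pos y 2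
  have := pos (y + 1) 2
  have := pos (y + 2) 2
  have := pos (y + 3) 2
  clear pos e1 e2 e3 e4 e5 e6 e7 e8
  generalize (∏ i ∈ Finset.range n, ((x + 2 * i)! : ℚ)) = x0 at *
  generalize (∏ i ∈ Finset.range n, ((x + 1 + 2 * i)! : ℚ)) = x1 at *
  generalize (∏ i ∈ Finset.range n, ((x + 2 + 2 * i)! : ℚ)) = x2 at *
  generalize (∏ i ∈ Finset.range n, ((x + 3 + 2 * i)! : ℚ)) = x3 at *
  generalize (∏ i ∈ Finset.range n, ((y + 2 * i)! : ℚ)) = y0 at *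
  generalize (∏ i ∈ Finset.range n, ((y + 1 + 2 * i)! : ℚ)) = y1 at *
  generalize (∏ i ∈ Finset.range n, ((y + 2 + 2 * i)! : ℚ)) = y2 at *
  generalize (∏ i ∈ Finset.range n, ((y + 3 + 2 * i)! : ℚ)) = y3 at *
  generalize (∏ i ∈ Finset.range n, ((p + 1 + i)! : ℚ)) = p1 at *
  generalize (∏ i ∈ Finset.range n, ((p + 2 + i)! : ℚ)) = p2 at *
  generalize (∏ i ∈ Finset.range n, ((p + 3 + i)! : ℚ)) = p3 at *
  generalize (∏ i ∈ Finset.range n, (i ! : ℚ)) = g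
  generalize (∏ i ∈ Finset.range n, (ascPochhammer ℚ i).eval (2 * (x : ℚ) + y + 3 + 2 * i)) = a
  generalize (∏ i ∈ Finset.range n, (ascPochhammer ℚ i).eval (2 * (x : ℚ) + y + 6 + 2 * i)) = b
  generalize (∏ i ∈ Finset.range n, (ascPochhammer ℚ i).eval ((x : ℚ) + 2 * y + 3 + 2 * i)) = c
  generalize (∏ i ∈ Finset.range n, (ascPochhammer ℚ i).eval ((x : ℚ) + 2 * y + 6 + 2 * i)) = d
  have hd : (p2 ^ 2 * (p + 2 + n)) * (x2 * x1 * (x + 1 + 2 * n)) * (y2 * y1 * (y + 1 + 2 * n)) =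
      (p3 * p1 * (p + 2)) * (x3 * x0 * (x + 1)) * (y3 * y0 * (y + 1)) := by
    rw [h2, h3]
    linear_combination (x2 * x1 * (x + 1 + 2 * n)) * (y2 * y1 * (y + 1 + 2 * n)) * h1
  rw [div_mul_div_comm, div_mul_div_comm, div_mul_eq_mul_div, div_mul_eq_mul_div,
    div_eq_div_iff (by positivity) (by positivity)]
  linear_combination g ^ 2 * a * b * c * d * hd

/-- Krattenthaler's evaluation of the determinant of `factorialMatrix`, by condensation. -/
theorem det_factorialMatrix (n p x y : ℕ) (h : x + y = p + 1) :
    (factorialMatrix n p x y).det = factorialProduct n p x y := by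
  induction n using Nat.strong_induction_on generalizing p x y with
  | _ n ih =>
  match n, ih with
  | 0, _ => simp [factorialProduct]
  | 1, _ => simp [factorialProduct, factorialMatrix]; ring
  | n + 2, ih =>
    have hc := det_factorialMatrix_condensation n p x y
    have h1 := ih (n + 1) (by omega) p x y h
    have h2 := ih (n + 1) (by omega) (p + 2) (x + 1) (y + 1) (by omega)
    have h3 := ih n (by omega) (p + 2) (x + 1) (y + 1) (by omega)
    push_cast at h2 h3
    rw [h1, h2, h3] at hc
    have hpos := factorialProduct_pos n (p + 2) (x + 1) (y + 1) (by omega)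
    have hm := factorialProduct_mul n p x y h
    have hq : (0 : ℚ) < (x + y + n + 1) * (x + 2 * n + 2) * (y + 2 * n + 2) := by positivity
    refine mul_right_cancel₀ hpos.ne' (mul_right_cancel₀ hq.ne' ?_)
    rw [hm, hc]
    -- Relative to the common product of the two diagonal minors, with `N = n + 1`, the recursion
    -- becomes `(x + y + N)(x + 2N)(y + 2N) - xy(x + y) = N(2x + y + 2N)(x + 2y + 2N)`. The term
    -- `xy(x + y)` comes from the off-diagonal minors treated here.
    have hT : (factorialMatrix (n + 1) (p + 1) (x + 2) (y - 1)).det *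
        (factorialMatrix (n + 1) (p + 1) (x - 1) (y + 2)).det *
        ((x + y + n + 1) * (x + 2 * n + 2) * (y + 2 * n + 2)) =
        factorialProduct (n + 1) (p + 2) (x + 1) (y + 1) * factorialProduct (n + 1) p x y *
          (x * y * (x + y)) := by
      -- At `x = 0` or `y = 0` a parameter `-1` leaves the range of the induction hypothesis, but
      -- then one minor has a zero row or column, in accordance with the factor `x * y`.
      rcases Nat.eq_zero_or_pos x with rfl | hx
      · have := det_factorialMatrix_neg_one_left n (p + 1) (y + 2)
        simp [this]
      rcases Nat.eq_zero_or_pos y with rfl | hy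
      · have := det_factorialMatrix_neg_one_right n (p + 1) (x + 2)
        simp [this]
      obtain ⟨x, rfl⟩ := Nat.exists_eq_succ_of_ne_zero hx.ne'
      obtain ⟨y, rfl⟩ := Nat.exists_eq_succ_of_ne_zero hy.ne'
      obtain ⟨p, rfl⟩ := Nat.exists_eq_succ_of_ne_zero (show p ≠ 0 by omega)
      have h4 := ih (n + 1) (by omega) (p + 2) (x + 3) y (by omega)
      have h5 := ih (n + 1) (by omega) (p + 2) x (y + 3) (by omega)
      have h6 := factorialProduct_mul_shift (n + 1) p x y
      have hp : (x : ℚ) + 1 + y = p + 1 := by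
        have : x + 1 + y = p + 1 := by omega
        exact_mod_cast this
      rw [← h4, ← h5] at h6
      push_cast at h6 ⊢
      rw [show (x : ℤ) + 1 + 2 = x + 3 by ring, show (y : ℤ) + 1 + 2 = y + 3 by ring,
        show (x : ℤ) + 1 - 1 = x by ring, show (y : ℤ) + 1 - 1 = y by ring]
      simp only [Nat.succ_eq_add_one, add_assoc] at h6 ⊢
      norm_num at h6 ⊢
      have hp' : (p : ℚ) = x + y := by linarith
      rw [hp'] at h6
      linear_combination h6
    linear_combination (-1 : ℚ) * hT

end FactorialDeterminant

/-! ### Adjacency of unit triangles and expansion of weighted tiling sums -/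

namespace TriLattice

/-- Two unit triangles sharing an edge. -/
def Adjacent (s t : UnitTriangle) : Prop := (s.corners ∩ t.corners).card = 2

theorem Adjacent.symm {s t : UnitTriangle} (h : Adjacent s t) : Adjacent t s := by
  rwa [Adjacent, Finset.inter_comm]

theorem UnitTriangle.card_corners (t : UnitTriangle) : t.corners.card = 3 := by
  unfold UnitTriangle.corners
  split <;> rw [Finset.card_eq_three]
  · exact ⟨_, _, _, by simp, by simp, by simp, rfl⟩
  · exact ⟨_, _, _, by simp, by simp, by simp, rfl⟩

theorem Adjacent.ne {s t : UnitTriangle} (h : Adjacent s t) : s ≠ t := by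
  rintro rfl
  rw [Adjacent, Finset.inter_self, UnitTriangle.card_corners] at h
  omega

theorem adjacent_up_iff {x y : ℤ} {t : UnitTriangle} :
    Adjacent ⟨x, y, true⟩ t ↔
      t = ⟨x, y, false⟩ ∨ t = ⟨x, y - 1, false⟩ ∨ t = ⟨x - 1, y, false⟩ := by
  constructor
  · intro h
    have hne := h.ne
    obtain ⟨p, q, hpq, hI⟩ := Finset.card_eq_two.1 h
    have hp : p ∈ (⟨x, y, true⟩ : UnitTriangle).corners ∩ t.corners := by simp [hI]
    have hq : q ∈ (⟨x, y, true⟩ : UnitTriangle).corners ∩ t.corners := by simp [hI]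
    obtain ⟨x', y', u⟩ := t
    obtain ⟨p1, p2⟩ := p
    obtain ⟨q1, q2⟩ := q
    cases u <;>
    simp [UnitTriangle.corners] at hp hq hpq hne ⊢ <;> omega
  · have aux : ∀ (s t : UnitTriangle) (p q : ℤ × ℤ), p ≠ q → s.corners ∩ t.corners = {p, q} →
        Adjacent s t := fun s t p q h e => Finset.card_eq_two.2 ⟨p, q, h, e⟩
    rintro (rfl | rfl | rfl)
    · refine aux _ _ (x + 1, y) (x, y + 1) (by simp) ?_
      ext ⟨p, q⟩
      simp [UnitTriangle.corners]
    · refine aux _ _ (x, y) (x + 1, y) (by simp) ?_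
      ext ⟨p, q⟩
      simp [UnitTriangle.corners]
    · refine aux _ _ (x, y) (x, y + 1) (by simp) ?_
      ext ⟨p, q⟩
      simp [UnitTriangle.corners]

theorem adjacent_down_iff {x y : ℤ} {t : UnitTriangle} :
    Adjacent ⟨x, y, false⟩ t ↔
      t = ⟨x, y, true⟩ ∨ t = ⟨x, y + 1, true⟩ ∨ t = ⟨x + 1, y, true⟩ := by
  obtain ⟨x', y', u⟩ := t
  cases u
  · simp only [UnitTriangle.mk.injEq, Bool.false_eq_true, and_false, or_false, iff_false]
    intro h
    have hne := h.ne
    obtain ⟨p, q, hpq, hI⟩ := Finset.card_eq_two.1 h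
    have hp : p ∈ (⟨x, y, false⟩ : UnitTriangle).corners ∩
      (⟨x', y', false⟩ : UnitTriangle).corners := by simp [hI]
    have hq : q ∈ (⟨x, y, false⟩ : UnitTriangle).corners ∩
      (⟨x', y', false⟩ : UnitTriangle).corners := by simp [hI]
    obtain ⟨p1, p2⟩ := p
    obtain ⟨q1, q2⟩ := q
    simp [UnitTriangle.corners] at hp hq hpq hne
    omega
  · rw [show Adjacent ⟨x, y, false⟩ ⟨x', y', true⟩ ↔ Adjacent ⟨x', y', true⟩ ⟨x, y, false⟩ from
      ⟨Adjacent.symm, Adjacent.symm⟩, adjacent_up_iff]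
    simp only [UnitTriangle.mk.injEq, and_true]
    omega

/-- The sum over all lozenge tilings of `R` of the product of the weights of their lozenges. -/
noncomputable def tilingSum (w : Region → ℚ) (R : Region) : ℚ :=
  ∑ T ∈ tilings R, ∏ l ∈ T, w l

theorem IsLozengeTiling.eq_of_mem {R : Region} {T : Finset Region} (hT : IsLozengeTiling R T)
    {l l' : Region} (hl : l ∈ T) (hl' : l' ∈ T) {t : UnitTriangle} (ht : t ∈ l) (ht' : t ∈ l') :
    l = l' := by
  by_contra h
  exact Finset.disjoint_left.1 (hT.2.1 hl hl' h) ht ht'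

theorem IsLozengeTiling.exists_adjacent {R : Region} {T : Finset Region}
    (hT : IsLozengeTiling R T) {t : UnitTriangle} (ht : t ∈ R) :
    ∃ t', Adjacent t t' ∧ ({t, t'} : Region) ∈ T := by
  rw [← hT.2.2, Finset.mem_biUnion] at ht
  obtain ⟨l, hl, htl⟩ := ht
  obtain ⟨s, s', hs, rfl⟩ := hT.1 l hl
  simp only [id, Finset.mem_insert, Finset.mem_singleton] at htl
  rcases htl with rfl | rfl
  · exact ⟨s', hs, hl⟩
  · exact ⟨s, Adjacent.symm hs, by rwa [Finset.pair_comm]⟩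

theorem IsLozengeTiling.subset {R : Region} {T : Finset Region} (hT : IsLozengeTiling R T)
    {l : Region} (hl : l ∈ T) : l ⊆ R := by
  rw [← hT.2.2]
  exact Finset.subset_biUnion_of_mem id hl

theorem IsLozengeTiling.erase {R : Region} {T : Finset Region} (hT : IsLozengeTiling R T)
    {l : Region} (hl : l ∈ T) : IsLozengeTiling (R \ l) (T.erase l) := by
  refine ⟨fun m hm => hT.1 m (Finset.mem_of_mem_erase hm),
    hT.2.1.subset (by simp), ?_⟩
  ext t
  simp only [Finset.mem_biUnion, Finset.mem_erase, Finset.mem_sdiff, id]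
  constructor
  · rintro ⟨m, ⟨hm, hmT⟩, ht⟩
    exact ⟨hT.subset hmT ht, fun h => hm (hT.eq_of_mem hmT hl ht h)⟩
  · rintro ⟨ht, htl⟩
    rw [← hT.2.2, Finset.mem_biUnion] at ht
    obtain ⟨m, hm, htm⟩ := ht
    exact ⟨m, ⟨fun h => htl (h ▸ htm), hm⟩, htm⟩

theorem IsLozengeTiling.union {R S : Region} {T U : Finset Region} (hT : IsLozengeTiling R T)
    (hU : IsLozengeTiling S U) (hRS : Disjoint R S) : IsLozengeTiling (R ∪ S) (T ∪ U) := by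
  refine ⟨fun m hm => (Finset.mem_union.1 hm).elim (hT.1 m) (hU.1 m), ?_, ?_⟩
  · rw [Finset.coe_union, Set.pairwiseDisjoint_union]
    refine ⟨hT.2.1, hU.2.1, fun l hl m hm _ => ?_⟩
    exact Finset.disjoint_of_subset_left (hT.subset hl)
      (Finset.disjoint_of_subset_right (hU.subset hm) hRS)
  · rw [Finset.union_biUnion, hT.2.2, hU.2.2]

theorem isLozengeTiling_singleton {s t : UnitTriangle} (h : Adjacent s t) :
    IsLozengeTiling {s, t} {{s, t}} :=
  ⟨fun m hm => ⟨s, t, h, Finset.mem_singleton.1 hm⟩, by simp, by simp⟩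

theorem IsLozengeTiling.insert {R : Region} {T : Finset Region} {s t : UnitTriangle}
    (h : Adjacent s t) (hs : s ∈ R) (ht : t ∈ R) (hT : IsLozengeTiling (R \ {s, t}) T) :
    IsLozengeTiling R (insert {s, t} T) := by
  have h1 := (isLozengeTiling_singleton h).union hT Finset.disjoint_sdiff
  rwa [Finset.union_sdiff_of_subset, ← Finset.insert_eq] at h1
  simp [Finset.insert_subset_iff, hs, ht]

theorem IsLozengeTiling.notMem {R : Region} {T : Finset Region} {l : Region}
    (hT : IsLozengeTiling (R \ l) T) {s : UnitTriangle} (hs : s ∈ l) : l ∉ T := fun h =>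
  (Finset.mem_sdiff.1 (hT.subset h hs)).2 hs

open Classical in
/-- Expansion of the tiling sum along the lozenge covering a given triangle. -/
theorem tilingSum_eq_sum (w : Region → ℚ) {R : Region} {t : UnitTriangle} (ht : t ∈ R) :
    tilingSum w R =
      ∑ s ∈ R.filter (Adjacent t), w {t, s} * tilingSum w (R \ {t, s}) := by
  have h : tilings R = (R.filter (Adjacent t)).biUnion fun s =>
      (tilings (R \ {t, s})).image (insert {t, s}) := by
    ext T
    simp only [Finset.mem_biUnion, Finset.mem_image, mem_tilings, Finset.mem_filter]
    constructor
    · intro hT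
      obtain ⟨s, hs, hl⟩ := hT.exists_adjacent ht
      exact ⟨s, ⟨hT.subset hl (by simp), hs⟩, _, hT.erase hl, Finset.insert_erase hl⟩
    · rintro ⟨s, ⟨hsR, hs⟩, T', hT', rfl⟩
      exact hT'.insert hs ht hsR
  rw [tilingSum, h, Finset.sum_biUnion]
  · refine Finset.sum_congr rfl fun s hs => ?_
    rw [Finset.sum_image, tilingSum, Finset.mul_sum]
    · refine Finset.sum_congr rfl fun T hT => ?_
      rw [Finset.prod_insert]
      exact (mem_tilings.1 hT).notMem (s := t) (by simp)
    · intro T hT T' hT' hTT'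
      have h1 := (mem_tilings.1 hT).notMem (s := t) (by simp)
      have h2 := (mem_tilings.1 hT').notMem (s := t) (by simp)
      rw [← Finset.erase_insert h1, ← Finset.erase_insert h2]
      rw [hTT']
  · intro s hs s' hs' hss'
    rw [Function.onFun, Finset.disjoint_left]
    intro T hT hT'
    simp only [Finset.mem_image, mem_tilings, Finset.coe_filter, Set.mem_ofPred_eq] at hT hT' hs hs'
    obtain ⟨T1, hT1, rfl⟩ := hT
    obtain ⟨T2, hT2, h2⟩ := hT'
    have h3 := hT1.insert hs.2 ht hs.1
    have h4 := h3.eq_of_mem (Finset.mem_insert_self _ _) (h2 ▸ Finset.mem_insert_self _ _)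
      (t := t) (by simp) (l' := {t, s'}) (by simp)
    have h5 : s ∈ ({t, s'} : Region) := by rw [← h4]; simp
    simp only [Finset.mem_insert, Finset.mem_singleton] at h5
    exact h5.elim (fun h => hs.2.ne h.symm) hss'

theorem tilingSum_empty (w : Region → ℚ) : tilingSum w ∅ = 1 := by
  have : tilings ∅ = {∅} := by
    ext T
    rw [mem_tilings, Finset.mem_singleton]
    constructor
    · intro hT
      refine Finset.eq_empty_of_forall_notMem fun l hl => ?_
      obtain ⟨s, t, -, rfl⟩ := hT.1 l hl
      have := hT.subset hl (Finset.mem_insert_self s _)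
      simp at this
    · rintro rfl
      exact ⟨by simp, by simp, by simp⟩
  rw [tilingSum, this]
  simp

theorem tilingSum_up (w : Region → ℚ) {R : Region} {x y : ℤ} (ht : ⟨x, y, true⟩ ∈ R)
    (hl : ⟨x - 1, y, false⟩ ∉ R) :
    tilingSum w R =
      (if ⟨x, y, false⟩ ∈ R then w {⟨x, y, true⟩, ⟨x, y, false⟩} *
        tilingSum w (R \ {⟨x, y, true⟩, ⟨x, y, false⟩}) else 0) +
      (if ⟨x, y - 1, false⟩ ∈ R then w {⟨x, y, true⟩, ⟨x, y - 1, false⟩} *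
        tilingSum w (R \ {⟨x, y, true⟩, ⟨x, y - 1, false⟩}) else 0) := by
  classical
  rw [tilingSum_eq_sum w ht]
  have : R.filter (Adjacent ⟨x, y, true⟩) =
      ({⟨x, y, false⟩, ⟨x, y - 1, false⟩} : Region).filter (· ∈ R) := by
    ext s
    simp only [Finset.mem_filter, adjacent_up_iff, Finset.mem_insert, Finset.mem_singleton]
    constructor
    · rintro ⟨h, rfl | rfl | rfl⟩
      · exact ⟨Or.inl rfl, h⟩
      · exact ⟨Or.inr rfl, h⟩
      · exact absurd h hl
    · tauto
  rw [this, Finset.sum_filter, Finset.sum_pair (by simp; omega)]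

/-- With two of its three possible partners absent, the triangle has a forced lozenge. -/
theorem tilingSum_down (w : Region → ℚ) {R : Region} {x y : ℤ} (ht : ⟨x, y, false⟩ ∈ R)
    (h1 : ⟨x, y, true⟩ ∉ R) (h2 : ⟨x, y + 1, true⟩ ∉ R) :
    tilingSum w R =
      if ⟨x + 1, y, true⟩ ∈ R then w {⟨x, y, false⟩, ⟨x + 1, y, true⟩} *
        tilingSum w (R \ {⟨x, y, false⟩, ⟨x + 1, y, true⟩}) else 0 := by
  classical
  rw [tilingSum_eq_sum w ht]
  have : R.filter (Adjacent ⟨x, y, false⟩) =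
      ({⟨x + 1, y, true⟩} : Region).filter (· ∈ R) := by
    ext s
    simp only [Finset.mem_filter, adjacent_down_iff, Finset.mem_singleton]
    constructor
    · rintro ⟨h, rfl | rfl | rfl⟩
      · exact absurd h h1
      · exact absurd h h2
      · exact ⟨rfl, h⟩
    · tauto
  rw [this, Finset.sum_filter, Finset.sum_singleton]

/-! ### Sweeping the hexagon: tilings as a determinant of path sums -/

/-- The ordinates `y` such that the edge from `(x, y)` to `(x, y + 1)` lies in the hexagon
`H(a, b, c)`. -/
noncomputable def hexagonEdges (a b c : ℕ) (x : ℤ) : Finset ℤ :=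
  Finset.Ico (max 0 (-x)) (min ((a : ℤ) + c) (a + b - x))

theorem mem_hexagonEdges {a b c : ℕ} {x y : ℤ} :
    y ∈ hexagonEdges a b c x ↔ 0 ≤ y ∧ -x ≤ y ∧ y < (a : ℤ) + c ∧ y < a + b - x := by
  simp [hexagonEdges, and_assoc]

theorem up_mem_hexagon {a b c : ℕ} {x y : ℤ} :
    (⟨x, y, true⟩ : UnitTriangle) ∈ hexagon a b c ↔
      (-c ≤ x ∧ x < b) ∧ y ∈ hexagonEdges a b c x := by
  simp [mem_hexagon, UnitTriangle.corners, InHexagon, mem_hexagonEdges]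
  omega

theorem down_mem_hexagon {a b c : ℕ} {x y : ℤ} :
    (⟨x, y, false⟩ : UnitTriangle) ∈ hexagon a b c ↔
      (-c ≤ x ∧ x < b) ∧ y ∈ hexagonEdges a b c (x + 1) := by
  simp [mem_hexagon, UnitTriangle.corners, InHexagon, mem_hexagonEdges]
  omega

/-- The part of the hexagon to the right of the strip between the abscissas `t` and `t + 1`,
together with some of the triangles of this strip. -/
noncomputable def rightPart (a b c : ℕ) (t : ℤ) (U D : Finset ℤ) : Region :=
  U.image (fun y => ⟨t, y, true⟩) ∪ D.image (fun y => ⟨t, y, false⟩) ∪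
    (hexagon a b c).filter fun s => t < s.x

theorem up_mem_rightPart {a b c : ℕ} {t x y : ℤ} {U D : Finset ℤ} :
    (⟨x, y, true⟩ : UnitTriangle) ∈ rightPart a b c t U D ↔
      x = t ∧ y ∈ U ∨ t < x ∧ (⟨x, y, true⟩ : UnitTriangle) ∈ hexagon a b c := by
  simp only [rightPart, Finset.mem_union, Finset.mem_image, Finset.mem_filter,
    UnitTriangle.mk.injEq, Bool.false_eq_true, and_true, and_false, exists_false, or_false]
  aesop

theorem down_mem_rightPart {a b c : ℕ} {t x y : ℤ} {U D : Finset ℤ} :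
    (⟨x, y, false⟩ : UnitTriangle) ∈ rightPart a b c t U D ↔
      x = t ∧ y ∈ D ∨ t < x ∧ (⟨x, y, false⟩ : UnitTriangle) ∈ hexagon a b c := by
  simp only [rightPart, Finset.mem_union, Finset.mem_image, Finset.mem_filter,
    UnitTriangle.mk.injEq, Bool.true_eq_false, and_true, and_false, exists_false, false_or]
  aesop

theorem region_ext {R S : Region}
    (hu : ∀ x y, (⟨x, y, true⟩ : UnitTriangle) ∈ R ↔ (⟨x, y, true⟩ : UnitTriangle) ∈ S)
    (hd : ∀ x y, (⟨x, y, false⟩ : UnitTriangle) ∈ R ↔ (⟨x, y, false⟩ : UnitTriangle) ∈ S) :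
    R = S := by
  ext ⟨x, y, u⟩
  cases u
  · exact hd x y
  · exact hu x y

theorem rightPart_sdiff {a b c : ℕ} {t y z : ℤ} {U D : Finset ℤ} :
    rightPart a b c t U D \ {⟨t, y, true⟩, ⟨t, z, false⟩} =
      rightPart a b c t (U.erase y) (D.erase z) := by
  refine region_ext (fun x' y' => ?_) (fun x' y' => ?_)
  · simp only [Finset.mem_sdiff, up_mem_rightPart, Finset.mem_insert, Finset.mem_singleton,
      UnitTriangle.mk.injEq, Bool.true_eq_false, and_false, or_false, and_true, Finset.mem_erase]
    grind
  · simp only [Finset.mem_sdiff, down_mem_rightPart, Finset.mem_insert, Finset.mem_singleton,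
      UnitTriangle.mk.injEq, Bool.false_eq_true, and_false, false_or, and_true, Finset.mem_erase]
    grind

theorem tilingSum_rightPart_up (w : Region → ℚ) {a b c : ℕ} {t y : ℤ} {U D : Finset ℤ}
    (hy : y ∈ U) :
    tilingSum w (rightPart a b c t U D) =
      w {⟨t, y, true⟩, ⟨t, y, false⟩} *
        (if y ∈ D then tilingSum w (rightPart a b c t (U.erase y) (D.erase y)) else 0) +
      w {⟨t, y, true⟩, ⟨t, y - 1, false⟩} *
        (if y - 1 ∈ D then tilingSum w (rightPart a b c t (U.erase y) (D.erase (y - 1)))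
          else 0) := by
  rw [tilingSum_up (x := t) (y := y) w (up_mem_rightPart.2 (Or.inl ⟨rfl, hy⟩))
    (fun h => by rw [down_mem_rightPart] at h; omega)]
  simp only [rightPart_sdiff, mul_ite, mul_zero, down_mem_rightPart, lt_irrefl, false_and, or_false,
    true_and]

theorem tilingSum_rightPart_downs (w : Region → ℚ)
    (hw : ∀ x y, w {⟨x, y, false⟩, ⟨x + 1, y, true⟩} = 1) {a b c : ℕ} {t : ℤ}
    (D V U : Finset ℤ) (hD : D ⊆ U) :
    tilingSum w (D.image (fun y => ⟨t, y, false⟩) ∪ rightPart a b c (t + 1) U V) =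
      tilingSum w (rightPart a b c (t + 1) (U \ D) V) := by
  induction D using Finset.induction_on generalizing U with
  | empty => simp
  | insert y D hy ih =>
    have hyU := hD (Finset.mem_insert_self y D)
    rw [tilingSum_down (x := t) (y := y) w (by simp), if_pos, hw, one_mul,
      show U \ insert y D = U.erase y \ D by
        rw [Finset.sdiff_insert, ← Finset.erase_sdiff_comm], ← ih]
    · congr 1
      refine region_ext (fun x' y' => ?_) (fun x' y' => ?_)
      · simp only [Finset.mem_sdiff, Finset.mem_union, up_mem_rightPart, Finset.mem_image,
          Finset.mem_insert, Finset.mem_singleton, UnitTriangle.mk.injEq, Bool.false_eq_true,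
          Bool.true_eq_false, and_false, exists_false, false_or, and_true, Finset.mem_erase]
        grind
      · simp only [Finset.mem_sdiff, Finset.mem_union, down_mem_rightPart, Finset.mem_image,
          Finset.mem_insert, Finset.mem_singleton, UnitTriangle.mk.injEq, Bool.false_eq_true,
          and_false, or_false, and_true]
        grind
    · exact fun z hz => Finset.mem_erase.2
        ⟨fun h => hy (h ▸ hz), hD (Finset.mem_insert_of_mem hz)⟩
    · rw [Finset.mem_union, up_mem_rightPart]
      exact Or.inr (Or.inl ⟨rfl, hyU⟩)
    · rw [Finset.mem_union, up_mem_rightPart]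
      rintro (h | h)
      · simp at h
      · omega
    · rw [Finset.mem_union, up_mem_rightPart]
      rintro (h | h)
      · simp at h
      · omega

/-- The downward triangles left over in a strip must be joined to upward triangles of the next
strip. The upward triangles that remain there are the ones entered by paths. -/
theorem tilingSum_rightPart_empty (w : Region → ℚ)
    (hw : ∀ x y, w {⟨x, y, false⟩, ⟨x + 1, y, true⟩} = 1) {a b c : ℕ} {t : ℤ}
    (ht : -(c : ℤ) ≤ t + 1) (ht' : t + 1 < b) {D : Finset ℤ} (hD : D ⊆ hexagonEdges a b c (t + 1)) :
    tilingSum w (rightPart a b c t ∅ D) =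
      tilingSum w (rightPart a b c (t + 1) (hexagonEdges a b c (t + 1) \ D)
        (hexagonEdges a b c (t + 2))) := by
  rw [← tilingSum_rightPart_downs w hw _ _ _ hD]
  congr 1
  refine region_ext (fun x y => ?_) (fun x y => ?_)
  · simp only [Finset.mem_union, up_mem_rightPart, up_mem_hexagon]
    simp
    grind
  · simp only [Finset.mem_union, down_mem_rightPart, down_mem_hexagon]
    simp
    grind

/-- The weighted number of lattice paths of `n` steps from the edge at `(b - n, y)` to the edge at
`(b, j)`; the steps are weighted by the lozenges that they cross. -/
def pathSum (w : Region → ℚ) (b : ℤ) : ℕ → ℤ → ℤ → ℚ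
  | 0, y, j => if y = j then 1 else 0
  | n + 1, y, j =>
    w {⟨b - n - 1, y, true⟩, ⟨b - n - 1, y, false⟩} * pathSum w b n y j +
      w {⟨b - n - 1, y, true⟩, ⟨b - n - 1, y - 1, false⟩} * pathSum w b n (y - 1) j

theorem pathSum_eq_zero_of_lt (w : Region → ℚ) (b : ℤ) (n : ℕ) {y j : ℤ} (h : y < j) :
    pathSum w b n y j = 0 := by
  induction n generalizing y with
  | zero => simp [pathSum, h.ne]
  | succ n ih => rw [pathSum, ih h, ih (by omega)]; simp

theorem pathSum_eq_zero_of_gt (w : Region → ℚ) (b : ℤ) (n : ℕ) {y j : ℤ} (h : j + n < y) :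
    pathSum w b n y j = 0 := by
  induction n generalizing y with
  | zero => rw [pathSum, if_neg]; push_cast at h; omega
  | succ n ih =>
    push_cast at h
    rw [pathSum, ih (by omega), ih (by omega)]; simp

theorem eq_val_of_strictMono {a : ℕ} {g : Fin a → ℤ} (hg : StrictMono g)
    (h0 : ∀ i, 0 ≤ g i) (ha : ∀ i, g i < a) (i : Fin a) : g i = (i : ℕ) := by
  let g' : Fin a → Fin a := fun i => ⟨(g i).toNat, by have := h0 i; have := ha i; omega⟩
  have hg' : StrictMono g' := fun i j hij => by
    have := hg hij
    have := h0 i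
    have := h0 j
    change (g i).toNat < (g j).toNat
    omega
  have h : g' = id := (StrictMono.range_inj hg' strictMono_id).1 (by
    rw [(Finite.injective_iff_surjective.1 hg'.injective).range_eq, Set.range_id])
  have h1 : (g i).toNat = i := congrArg Fin.val (congrFun h i)
  have := h0 i
  omega

/-- Row linearity replaces the usual sign-reversing involution. The paths entering the strip are
advanced one at a time; rows below `m` belong to paths already moved to `g i`, the others to paths
still at `f i`. The two choices for the next path split its row by the recursion of `pathSum`, and
inadmissible choices contribute singular matrices. -/
theorem tilingSum_rightPart_step (w : Region → ℚ) {a b c n : ℕ}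
    (ih : ∀ g : Fin a → ℤ, StrictMono g → (∀ i, g i ∈ hexagonEdges a b c (b - n)) →
      tilingSum w (rightPart a b c (b - n - 1) ∅
        (hexagonEdges a b c (b - n) \ Finset.univ.image g)) =
      (Matrix.of fun i j : Fin a => pathSum w b n (g i) (j : ℕ)).det)
    {f : Fin a → ℤ} (hf : StrictMono f) (hfm : ∀ i, f i ∈ hexagonEdges a b c (b - n - 1))
    {m k : ℕ} (hmk : m + k = a) {g : Fin a → ℤ}
    (hg : ∀ i : Fin a, (i : ℕ) < m → g i ∈ hexagonEdges a b c (b - n) ∧ (g i = f i ∨ g i = f i - 1))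
    (hinj : ∀ i j : Fin a, (i : ℕ) < m → (j : ℕ) < m → g i = g j → i = j) :
    tilingSum w (rightPart a b c (b - n - 1)
      ((Finset.univ.filter fun i : Fin a => m ≤ (i : ℕ)).image f)
      (hexagonEdges a b c (b - n) \
        (Finset.univ.filter fun i : Fin a => (i : ℕ) < m).image g)) =
      (Matrix.of fun i j : Fin a => if (i : ℕ) < m then pathSum w b n (g i) (j : ℕ)
        else pathSum w b (n + 1) (f i) (j : ℕ)).det := by
  induction k generalizing m g with
  | zero =>
    obtain rfl : m = a := by omega
    have hg' : StrictMono g := by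
      intro i j hij
      have h1 := hf hij
      have h2 := (hg i i.2).2
      have h3 := (hg j j.2).2
      have h4 : g i ≠ g j := fun h => hij.ne (hinj i j i.2 j.2 h)
      omega
    have e1 : (Finset.univ.filter fun i : Fin m => m ≤ (i : ℕ)) = ∅ :=
      Finset.filter_eq_empty_iff.2 fun i _ => by omega
    have e2 : (Finset.univ.filter fun i : Fin m => (i : ℕ) < m) = Finset.univ :=
      Finset.filter_true_of_mem fun i _ => i.2
    rw [e1, e2, Finset.image_empty, ih g hg' fun i => (hg i i.2).1]
    congr 1
    ext i j
    rw [Matrix.of_apply, Matrix.of_apply, if_pos i.2]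
  | succ k ihk =>
    have hma : m < a := by omega
    let i₀ : Fin a := ⟨m, hma⟩
    set U := (Finset.univ.filter fun i : Fin a => m ≤ (i : ℕ)).image f with hU
    set D := hexagonEdges a b c (b - n) \
        (Finset.univ.filter fun i : Fin a => (i : ℕ) < m).image g with hD
    set M : Matrix (Fin a) (Fin a) ℚ := Matrix.of fun i j : Fin a =>
      if (i : ℕ) < m then pathSum w b n (g i) (j : ℕ) else pathSum w b (n + 1) (f i) (j : ℕ) with hM
    have key : ∀ z, (z = f i₀ ∨ z = f i₀ - 1) →
        (if z ∈ D then tilingSum w (rightPart a b c (b - n - 1) (U.erase (f i₀)) (D.erase z))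
          else 0) = (M.updateRow i₀ fun j => pathSum w b n z (j : ℕ)).det := by
      intro z hz
      split_ifs with hzD
      · have hzD' := hzD
        simp only [hD, Finset.mem_sdiff, Finset.mem_image, Finset.mem_filter, Finset.mem_univ,
          true_and, not_exists, not_and] at hzD'
        have hlt : ∀ i : Fin a, (i : ℕ) < m + 1 ↔ (i : ℕ) < m ∨ i = i₀ := by
          intro i
          rw [Fin.ext_iff]
          change _ ↔ _ ∨ (i : ℕ) = m
          omega
        have hne : ∀ i : Fin a, (i : ℕ) < m → i ≠ i₀ := by
          rintro i hi rfl
          exact absurd hi (lt_irrefl m)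
        have h := @ihk (m + 1) (by omega) (Function.update g i₀ z) (fun i hi => by
            rcases (hlt i).1 hi with h | rfl
            · rw [Function.update_of_ne (hne i h)]; exact hg i h
            · rw [Function.update_self]; exact ⟨hzD'.1, hz⟩)
          (fun i j hi hj hij => by
            rcases (hlt i).1 hi with h | rfl <;> rcases (hlt j).1 hj with h' | rfl
            · rw [Function.update_of_ne (hne i h), Function.update_of_ne (hne j h')] at hij
              exact hinj i j h h' hij
            · rw [Function.update_of_ne (hne i h), Function.update_self] at hij
              exact absurd hij (hzD'.2 i h)
            · rw [Function.update_of_ne (hne j h'), Function.update_self] at hij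
              exact absurd hij.symm (hzD'.2 j h')
            · rfl)
        convert h using 2
        · congr 1
          · ext y
            simp only [hU, Finset.mem_erase, Finset.mem_image, Finset.mem_filter, Finset.mem_univ,
              true_and]
            constructor
            · rintro ⟨h1, i, h2, rfl⟩
              refine ⟨i, ?_, rfl⟩
              rcases Nat.lt_or_ge m i with h3 | h3
              · exact h3
              · exact absurd (congrArg f (Fin.ext (show (i : ℕ) = i₀ from le_antisymm h3 h2))) h1
            · rintro ⟨i, h2, rfl⟩
              refine ⟨fun h => ?_, i, by omega, rfl⟩
              have := congrArg Fin.val (hf.injective h)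
              change (i : ℕ) = m at this
              omega
          · ext y
            simp only [hD, Finset.mem_erase, Finset.mem_image, Finset.mem_filter, Finset.mem_univ,
              true_and, Finset.mem_sdiff, not_exists, not_and]
            constructor
            · rintro ⟨h1, h2, h3⟩
              refine ⟨h2, fun i hi => ?_⟩
              rcases (hlt i).1 hi with h | rfl
              · rw [Function.update_of_ne (hne i h)]; exact h3 i h
              · rw [Function.update_self]; exact fun h => h1 h.symm
            · rintro ⟨h1, h2⟩
              refine ⟨fun h => ?_, h1, fun i hi => ?_⟩
              · have := h2 i₀ (Nat.lt_succ_self m)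
                rw [Function.update_self] at this
                exact this h.symm
              · have := h2 i (by omega)
                rwa [Function.update_of_ne (hne i hi)] at this
        · ext i j
          by_cases hi : i = i₀
          · subst hi
            rw [Matrix.updateRow_self, Matrix.of_apply, if_pos (Nat.lt_succ_self m),
              Function.update_self]
          · rw [Matrix.updateRow_ne hi, hM, Matrix.of_apply, Matrix.of_apply,
              Function.update_of_ne hi]
            have : (i : ℕ) < m + 1 ↔ (i : ℕ) < m :=
              ⟨fun h => ((hlt i).1 h).resolve_right hi, fun h => Nat.lt_succ_of_lt h⟩
            simp only [this]
      · by_cases hz' : z ∈ hexagonEdges a b c (b - n)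
        · have : ∃ i : Fin a, (i : ℕ) < m ∧ g i = z := by
            by_contra hcon
            refine hzD ?_
            simp only [hD, Finset.mem_sdiff, Finset.mem_image, Finset.mem_filter, Finset.mem_univ,
              true_and]
            exact ⟨hz', hcon⟩
          obtain ⟨i, hi, rfl⟩ := this
          have hii : i ≠ i₀ := by
            rintro rfl
            exact lt_irrefl m hi
          symm
          -- The target is already taken by another path: two rows coincide.
          refine Matrix.det_zero_of_row_eq hii ?_
          ext j
          rw [Matrix.updateRow_self, Matrix.updateRow_ne hii, hM, Matrix.of_apply, if_pos hi]
        · symm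
          -- The target is outside the hexagon: it is negative or at least `a + n`, and no path of
          -- `n` steps leads from there to an ordinate `j` in `[0, a)`.
          refine Matrix.det_eq_zero_of_row_eq_zero i₀ fun j => ?_
          rw [Matrix.updateRow_self]
          have h1 := hfm i₀
          rw [mem_hexagonEdges] at hz' h1
          have hj := j.2
          rcases lt_or_ge z 0 with h2 | h2
          · exact pathSum_eq_zero_of_lt _ _ _ (by omega)
          · exact pathSum_eq_zero_of_gt _ _ _ (by omega)
    rw [tilingSum_rightPart_up w (y := f i₀), key _ (Or.inl rfl), key _ (Or.inr rfl),
      ← Matrix.det_updateRow_smul, ← Matrix.det_updateRow_smul, ← Matrix.det_updateRow_add]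
    · congr 1
      ext i j
      by_cases hi : i = i₀
      · subst hi
        rw [Matrix.updateRow_self, hM, Matrix.of_apply, if_neg (lt_irrefl m), pathSum]
        simp
      · rw [Matrix.updateRow_ne hi]
    · rw [hU]
      exact Finset.mem_image_of_mem _ (by simp [i₀])

/-- The Lindström–Gessel–Viennot determinant for the tilings of the part of a hexagon to the right
of a vertical zig-zag line. -/
theorem tilingSum_rightPart_eq_det (w : Region → ℚ)
    (hw : ∀ x y, w {⟨x, y, false⟩, ⟨x + 1, y, true⟩} = 1) {a b c : ℕ} (n : ℕ) (hn : n ≤ b + c)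
    (g : Fin a → ℤ) (hg : StrictMono g) (hgm : ∀ i, g i ∈ hexagonEdges a b c (b - n)) :
    tilingSum w (rightPart a b c (b - n - 1) ∅
        (hexagonEdges a b c (b - n) \ Finset.univ.image g)) =
      (Matrix.of fun i j : Fin a => pathSum w b n (g i) (j : ℕ)).det := by
  induction n generalizing g with
  | zero =>
    have h0 : ∀ i, g i = (i : ℕ) := eq_val_of_strictMono hg
      (fun i => (mem_hexagonEdges.1 (hgm i)).1)
      (fun i => by have := (mem_hexagonEdges.1 (hgm i)).2.2.2; push_cast at this; omega)
    have h1 : rightPart a b c (b - (0 : ℕ) - 1) ∅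
        (hexagonEdges a b c (b - (0 : ℕ)) \ Finset.univ.image g) = ∅ := by
      refine Finset.eq_empty_of_forall_notMem ?_
      rintro ⟨x, y, _ | _⟩
      · rw [down_mem_rightPart, down_mem_hexagon]
        rintro (⟨-, h⟩ | ⟨h, h', -⟩)
        · simp only [Finset.mem_sdiff, Finset.mem_image, Finset.mem_univ, true_and, h0,
            mem_hexagonEdges] at h
          refine h.2 ⟨⟨y.toNat, by omega⟩, ?_⟩
          change ((y.toNat : ℕ) : ℤ) = y
          omega
        · push_cast at h; omega
      · rw [up_mem_rightPart, up_mem_hexagon]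
        rintro (⟨-, h⟩ | ⟨h, h', -⟩)
        · simp at h
        · push_cast at h; omega
    rw [h1, tilingSum_empty]
    symm
    rw [← Matrix.det_one (n := Fin a) (R := ℚ)]
    congr 1
    ext i j
    simp [pathSum, h0, Matrix.one_apply, Fin.ext_iff]
  | succ n ih =>
    have e : (b : ℤ) - (n + 1 : ℕ) = b - n - 1 := by push_cast; ring
    rw [e] at hgm ⊢
    have hsub : Finset.univ.image g ⊆ hexagonEdges a b c (b - n - 1) := by
      intro y hy
      obtain ⟨i, -, rfl⟩ := Finset.mem_image.1 hy
      exact hgm i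
    have h1 := tilingSum_rightPart_empty w hw (a := a) (b := b) (c := c) (t := b - n - 1 - 1)
      (D := hexagonEdges a b c (b - n - 1) \ Finset.univ.image g) (by omega) (by omega)
      (by rw [sub_add_cancel]; exact Finset.sdiff_subset)
    rw [h1, sub_add_cancel, Finset.sdiff_sdiff_eq_self hsub,
      show (b : ℤ) - n - 1 - 1 + 2 = b - n by ring]
    -- At `m = 0` no path has moved yet, so the conditions on the new positions are vacuous and any
    -- function may be supplied for them.
    have h2 := tilingSum_rightPart_step w (ih (by omega)) hg hgm (zero_add a) (g := g)
      (fun i hi => absurd hi (Nat.not_lt_zero _)) (fun i j hi => absurd hi (Nat.not_lt_zero _))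
    simp only [Nat.zero_le, Finset.filter_true, Nat.not_lt_zero, Finset.filter_false,
      Finset.image_empty, Finset.sdiff_empty, if_false] at h2
    exact h2

/-- The Lindström–Gessel–Viennot determinant for the tilings of a hexagon. -/
theorem tilingSum_hexagon (w : Region → ℚ)
    (hw : ∀ x y, w {⟨x, y, false⟩, ⟨x + 1, y, true⟩} = 1) (a b c : ℕ) :
    tilingSum w (hexagon a b c) =
      (Matrix.of fun i j : Fin a => pathSum w b (b + c) ((c : ℤ) + (i : ℕ)) (j : ℕ)).det := by
  have e : (b : ℤ) - (b + c : ℕ) = -c := by push_cast; ring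
  have hm : ∀ i : Fin a, (c : ℤ) + (i : ℕ) ∈ hexagonEdges a b c (b - (b + c : ℕ)) := by
    intro i
    have := i.2
    rw [mem_hexagonEdges]
    omega
  rw [← tilingSum_rightPart_eq_det w hw (b + c) le_rfl _
    (fun i j hij => by simpa using hij) hm]
  congr 1
  refine region_ext (fun x y => ?_) (fun x y => ?_)
  · rw [up_mem_rightPart, up_mem_hexagon]
    simp only [Finset.notMem_empty, and_false, false_or]
    refine ⟨fun h => ⟨by omega, h⟩, fun h => h.2⟩
  · rw [down_mem_rightPart, down_mem_hexagon]
    refine ⟨fun h => Or.inr ⟨by omega, h⟩, ?_⟩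
    rintro (⟨-, h⟩ | h)
    · rw [Finset.mem_sdiff, mem_hexagonEdges] at h
      refine absurd (Finset.mem_image.2 ⟨⟨(y - c).toNat, by omega⟩, Finset.mem_univ _, ?_⟩) h.2
      change (c : ℤ) + ((y - c).toNat : ℕ) = y
      omega
    · exact h.2

/-! ### Replacing the removed staircases by zero weights -/

theorem updown_eq_updown {x y x' y' u v u' v' : ℤ} :
    ({⟨x, y, true⟩, ⟨x', y', false⟩} : Region) = {⟨u, v, true⟩, ⟨u', v', false⟩} ↔
      (x = u ∧ y = v) ∧ x' = u' ∧ y' = v' := by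
  constructor
  · intro h
    have h1 : (⟨x, y, true⟩ : UnitTriangle) ∈ ({⟨u, v, true⟩, ⟨u', v', false⟩} : Region) := by
      rw [← h]; simp
    have h2 : (⟨x', y', false⟩ : UnitTriangle) ∈ ({⟨u, v, true⟩, ⟨u', v', false⟩} : Region) := by
      rw [← h]; simp
    simpa using And.intro h1 h2
  · rintro ⟨⟨rfl, rfl⟩, rfl, rfl⟩
    rfl

/-- The positions of the upward (and of the downward) triangles of the northwestern staircase. -/
def InNW (a c : ℕ) (x y : ℤ) : Prop := -(c : ℤ) ≤ x ∧ x + 2 * c < y ∧ y < a + c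

/-- The positions of the downward triangles of the eastern staircase. -/
def InEast (a b : ℕ) (x y : ℤ) : Prop := x < b ∧ 2 * (b - 1 - x) < y ∧ y < a + b - 1 - x

/-- The positions of the upward triangles of the lozenges along the northwestern cut. -/
def OnNWCut (a c : ℕ) (x y : ℤ) : Prop := -(c : ℤ) ≤ x ∧ x + 2 * c = y ∧ y < a + c

theorem up_mem_nwStaircase {a b c : ℕ} (hab : a ≤ b) {x y : ℤ} :
    (⟨x, y, true⟩ : UnitTriangle) ∈ nwStaircase a b c ↔ InNW a c x y := by
  simp only [nwStaircase, nwRhombus, Finset.mem_biUnion, Finset.mem_filter, Finset.mem_product,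
    Finset.mem_range, min_eq_left hab, Finset.mem_insert, Finset.mem_singleton,
    UnitTriangle.mk.injEq, and_true, Bool.true_eq_false, and_false, or_false, Prod.exists, InNW]
  constructor
  · rintro ⟨k, l, h⟩; omega
  · intro h; exact ⟨(x + c).toNat, (a + c - 1 - y).toNat, by omega⟩

theorem down_mem_nwStaircase {a b c : ℕ} (hab : a ≤ b) {x y : ℤ} :
    (⟨x, y, false⟩ : UnitTriangle) ∈ nwStaircase a b c ↔ InNW a c x y := by
  simp only [nwStaircase, nwRhombus, Finset.mem_biUnion, Finset.mem_filter, Finset.mem_product,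
    Finset.mem_range, min_eq_left hab, Finset.mem_insert, Finset.mem_singleton,
    UnitTriangle.mk.injEq, and_true, Bool.false_eq_true, and_false, false_or, Prod.exists, InNW]
  constructor
  · rintro ⟨k, l, h⟩; omega
  · intro h; exact ⟨(x + c).toNat, (a + c - 1 - y).toNat, by omega⟩

theorem up_mem_eastStaircase {a b c : ℕ} (hac : a ≤ c) {x y : ℤ} :
    (⟨x, y, true⟩ : UnitTriangle) ∈ eastStaircase a b c ↔ InEast a b x (y - 1) := by
  simp only [eastStaircase, eastRhombus, Finset.mem_biUnion, Finset.mem_filter, Finset.mem_product,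
    Finset.mem_range, min_eq_left hac, Finset.mem_insert, Finset.mem_singleton,
    UnitTriangle.mk.injEq, and_true, Bool.true_eq_false, and_false, or_false, Prod.exists, InEast]
  constructor
  · rintro ⟨k, l, h⟩; omega
  · intro h; exact ⟨(a + b - 1 - x - y).toNat, (b - 1 - x).toNat, by omega⟩

theorem down_mem_eastStaircase {a b c : ℕ} (hac : a ≤ c) {x y : ℤ} :
    (⟨x, y, false⟩ : UnitTriangle) ∈ eastStaircase a b c ↔ InEast a b x y := by
  simp only [eastStaircase, eastRhombus, Finset.mem_biUnion, Finset.mem_filter, Finset.mem_product,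
    Finset.mem_range, min_eq_left hac, Finset.mem_insert, Finset.mem_singleton,
    UnitTriangle.mk.injEq, and_true, Bool.false_eq_true, and_false, false_or, Prod.exists, InEast]
  constructor
  · rintro ⟨k, l, h⟩; omega
  · intro h; exact ⟨(a + b - 2 - x - y).toNat, (b - 1 - x).toNat, by omega⟩

theorem mem_nwCutPositions {a b c : ℕ} (hab : a ≤ b) {x y x' y' : ℤ} :
    ({⟨x, y, true⟩, ⟨x', y', false⟩} : Region) ∈ nwCutPositions a b c ↔
      OnNWCut a c x y ∧ x' = x ∧ y' = y := by
  simp only [nwCutPositions, nwRhombus, Finset.mem_image, Finset.mem_filter, Finset.mem_product,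
    Finset.mem_range, min_eq_left hab, updown_eq_updown, Prod.exists, OnNWCut]
  constructor
  · rintro ⟨k, l, h⟩; omega
  · intro h; exact ⟨(x + c).toNat, (a + c - 1 - y).toNat, by omega⟩

/-- A lozenge that overlaps one of the two staircases without belonging to their tilings, and
has a side in common with that staircase. -/
def ForbiddenLozenge (a b c : ℕ) (l : Region) : Prop :=
  (∃ x y, InNW a c x y ∧ l = {⟨x, y, true⟩, ⟨x, y - 1, false⟩}) ∨
    ∃ x y, InEast a b x y ∧ l = {⟨x, y, true⟩, ⟨x, y, false⟩}

open Classical in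
/-- The weight on the lozenges of the hexagon that forces the staircases and puts the weight
`1 / 2` on the positions along the northwestern cut. -/
noncomputable def cutWeight (a b c : ℕ) (l : Region) : ℚ :=
  if ForbiddenLozenge a b c l then 0 else if l ∈ nwCutPositions a b c then 1 / 2 else 1

theorem cutWeight_of_forbidden {a b c : ℕ} {l : Region} (h : ForbiddenLozenge a b c l) :
    cutWeight a b c l = 0 := if_pos h

theorem forbidden_beta {a b c : ℕ} {x y : ℤ} :
    ForbiddenLozenge a b c {⟨x, y, true⟩, ⟨x, y, false⟩} ↔ InEast a b x y := by
  simp only [ForbiddenLozenge, updown_eq_updown]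
  constructor
  · rintro (⟨u, v, h, h'⟩ | ⟨u, v, h, ⟨rfl, rfl⟩, -⟩)
    · omega
    · exact h
  · exact fun h => Or.inr ⟨x, y, h, ⟨rfl, rfl⟩, rfl, rfl⟩

theorem forbidden_gamma {a b c : ℕ} {x y : ℤ} :
    ForbiddenLozenge a b c {⟨x, y, true⟩, ⟨x, y - 1, false⟩} ↔ InNW a c x y := by
  simp only [ForbiddenLozenge, updown_eq_updown]
  constructor
  · rintro (⟨u, v, h, ⟨rfl, rfl⟩, -⟩ | ⟨u, v, h, h'⟩)
    · exact h
    · omega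
  · exact fun h => Or.inl ⟨x, y, h, ⟨rfl, rfl⟩, rfl, rfl⟩

open Classical in
theorem cutWeight_beta {a b c : ℕ} (hab : a ≤ b) (x y : ℤ) :
    cutWeight a b c {⟨x, y, true⟩, ⟨x, y, false⟩} =
      if InEast a b x y then 0 else if OnNWCut a c x y then 1 / 2 else 1 := by
  rw [cutWeight]
  simp only [forbidden_beta, mem_nwCutPositions hab, and_true]

open Classical in
theorem cutWeight_gamma {a b c : ℕ} (hab : a ≤ b) (x y : ℤ) :
    cutWeight a b c {⟨x, y, true⟩, ⟨x, y - 1, false⟩} = if InNW a c x y then 0 else 1 := by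
  have h : y - 1 ≠ y := by omega
  rw [cutWeight]
  simp only [forbidden_gamma, mem_nwCutPositions hab, h, and_false, if_false]

theorem cutWeight_horizontal {a b c : ℕ} (hab : a ≤ b) (x y : ℤ) :
    cutWeight a b c {⟨x, y, false⟩, ⟨x + 1, y, true⟩} = 1 := by
  have h : ¬ (x = x + 1) := by omega
  rw [Finset.pair_comm, cutWeight, if_neg, if_neg]
  · rw [mem_nwCutPositions hab]
    tauto
  · simp only [ForbiddenLozenge, updown_eq_updown]
    rintro (⟨u, v, -, h'⟩ | ⟨u, v, -, h'⟩) <;> omega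

/-- The lozenges of the northwestern staircase. -/
def nwTiles (a c : ℕ) : Finset Region :=
  ((Finset.range a ×ˢ Finset.range a).filter fun q => q.1 + q.2 + 1 < a).image
    fun q => nwRhombus a c q.1 q.2

/-- The lozenges of the eastern staircase. -/
def eastTiles (a b : ℕ) : Finset Region :=
  ((Finset.range a ×ˢ Finset.range a).filter fun q => q.1 + q.2 + 1 < a).image
    fun q => eastRhombus a b q.1 q.2

theorem mem_nwTiles {a c : ℕ} {l : Region} :
    l ∈ nwTiles a c ↔ ∃ x y, InNW a c x y ∧ l = {⟨x, y, true⟩, ⟨x, y, false⟩} := by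
  simp only [nwTiles, nwRhombus, Finset.mem_image, Finset.mem_filter, Finset.mem_product,
    Finset.mem_range, Prod.exists]
  constructor
  · rintro ⟨k, l, h, rfl⟩
    exact ⟨_, _, by rw [InNW]; omega, rfl⟩
  · rintro ⟨x, y, h, rfl⟩
    rw [InNW] at h
    refine ⟨(x + c).toNat, (a + c - 1 - y).toNat, by omega, ?_⟩
    rw [updown_eq_updown]
    omega

theorem mem_eastTiles {a b : ℕ} {l : Region} :
    l ∈ eastTiles a b ↔ ∃ x y, InEast a b x y ∧ l = {⟨x, y + 1, true⟩, ⟨x, y, false⟩} := by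
  simp only [eastTiles, eastRhombus, Finset.mem_image, Finset.mem_filter, Finset.mem_product,
    Finset.mem_range, Prod.exists]
  constructor
  · rintro ⟨k, l, h, rfl⟩
    refine ⟨b - 1 - l, a - k + l - 1, by rw [InEast]; omega, ?_⟩
    rw [updown_eq_updown]
    omega
  · rintro ⟨x, y, h, rfl⟩
    rw [InEast] at h
    refine ⟨(a + b - 2 - x - y).toNat, (b - 1 - x).toNat, by omega, ?_⟩
    rw [updown_eq_updown]
    omega

theorem isLozengeTiling_staircases {a b c : ℕ} (hab : a ≤ b) (hac : a ≤ c) :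
    IsLozengeTiling (nwStaircase a b c ∪ eastStaircase a b c) (nwTiles a c ∪ eastTiles a b) := by
  have hnw : IsLozengeTiling (nwStaircase a b c) (nwTiles a c) := by
    refine ⟨fun l hl => ?_, fun l hl m hm hlm => ?_, ?_⟩
    · obtain ⟨x, y, -, rfl⟩ := mem_nwTiles.1 hl
      exact ⟨_, _, adjacent_up_iff.2 (Or.inl rfl), rfl⟩
    · obtain ⟨x, y, -, rfl⟩ := mem_nwTiles.1 hl
      obtain ⟨u, v, -, rfl⟩ := mem_nwTiles.1 hm
      rw [Function.onFun, id, id, Finset.disjoint_left]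
      rintro ⟨p, q, _ | _⟩ h1 h2 <;> simp at h1 h2 <;>
        exact hlm (updown_eq_updown.2 (by omega))
    · rw [nwTiles, Finset.image_biUnion, nwStaircase, min_eq_left hab]
      rfl
  have heast : IsLozengeTiling (eastStaircase a b c) (eastTiles a b) := by
    refine ⟨fun l hl => ?_, fun l hl m hm hlm => ?_, ?_⟩
    · obtain ⟨x, y, -, rfl⟩ := mem_eastTiles.1 hl
      exact ⟨_, _, adjacent_up_iff.2 (Or.inr (Or.inl (by rw [add_sub_cancel_right]))), rfl⟩
    · obtain ⟨x, y, -, rfl⟩ := mem_eastTiles.1 hl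
      obtain ⟨u, v, -, rfl⟩ := mem_eastTiles.1 hm
      rw [Function.onFun, id, id, Finset.disjoint_left]
      rintro ⟨p, q, _ | _⟩ h1 h2 <;> simp at h1 h2 <;>
        exact hlm (updown_eq_updown.2 (by omega))
    · rw [eastTiles, Finset.image_biUnion, eastStaircase, min_eq_left hac]
      rfl
  refine hnw.union heast (Finset.disjoint_left.2 ?_)
  rintro ⟨x, y, _ | _⟩
  · rw [down_mem_nwStaircase hab, down_mem_eastStaircase hac, InNW, InEast]; omega
  · rw [up_mem_nwStaircase hab, up_mem_eastStaircase hac, InNW, InEast]; omega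

theorem staircases_subset_hexagon {a b c : ℕ} (hab : a ≤ b) (hac : a ≤ c) :
    nwStaircase a b c ∪ eastStaircase a b c ⊆ hexagon a b c := by
  rintro ⟨x, y, _ | _⟩ h
  · rw [Finset.mem_union, down_mem_nwStaircase hab, down_mem_eastStaircase hac, InNW, InEast] at h
    rw [down_mem_hexagon, mem_hexagonEdges]
    omega
  · rw [Finset.mem_union, up_mem_nwStaircase hab, up_mem_eastStaircase hac, InNW, InEast] at h
    rw [up_mem_hexagon, mem_hexagonEdges]
    omega

/-- The staircase is forced column by column from the left. An upward triangle has one partner of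
weight zero, and its left partner is outside the hexagon or already covered, so only the staircase
lozenge is left. -/
theorem nwTiles_subset {a b c : ℕ} (hab : a ≤ b) (hac : a ≤ c) {T : Finset Region}
    (hT : IsLozengeTiling (hexagon a b c) T) (hw : ∀ l ∈ T, cutWeight a b c l ≠ 0) :
    nwTiles a c ⊆ T := by
  have key : ∀ (k : ℕ) (y : ℤ), InNW a c (-c + k) y →
      ({⟨-c + k, y, true⟩, ⟨-c + k, y, false⟩} : Region) ∈ T := by
    intro k
    induction k with
    | zero =>
      intro y h
      have hm := staircases_subset_hexagon hab hac
        (Finset.mem_union_left _ ((up_mem_nwStaircase hab).2 h))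
      obtain ⟨t, ht, htT⟩ := hT.exists_adjacent hm
      rcases adjacent_up_iff.1 ht with rfl | rfl | rfl
      · exact htT
      · exact absurd (cutWeight_of_forbidden (forbidden_gamma.2 h)) (hw _ htT)
      · have := hT.subset htT (Finset.mem_insert_of_mem (Finset.mem_singleton_self _))
        rw [down_mem_hexagon] at this
        omega
    | succ k ih =>
      intro y h
      have hm := staircases_subset_hexagon hab hac
        (Finset.mem_union_left _ ((up_mem_nwStaircase hab).2 h))
      obtain ⟨t, ht, htT⟩ := hT.exists_adjacent hm
      rcases adjacent_up_iff.1 ht with rfl | rfl | rfl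
      · exact htT
      · exact absurd (cutWeight_of_forbidden (forbidden_gamma.2 h)) (hw _ htT)
      · have h1 := ih y (by rw [InNW] at h ⊢; omega)
        have h2 := hT.eq_of_mem htT h1 (t := ⟨-c + k, y, false⟩)
          (by simp; omega) (by simp)
        rw [updown_eq_updown] at h2
        omega
  intro l hl
  obtain ⟨x, y, h, rfl⟩ := mem_nwTiles.1 hl
  have hx : x = -c + ((x + c).toNat : ℕ) := by rw [InNW] at h; omega
  rw [hx] at h ⊢
  exact key _ y h

/-- The same forcing, applied to downward triangles and proceeding from the rightmost column to the
left. -/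
theorem eastTiles_subset {a b c : ℕ} (hab : a ≤ b) (hac : a ≤ c) {T : Finset Region}
    (hT : IsLozengeTiling (hexagon a b c) T) (hw : ∀ l ∈ T, cutWeight a b c l ≠ 0) :
    eastTiles a b ⊆ T := by
  have key : ∀ (l : ℕ) (y : ℤ), InEast a b (b - 1 - l) y →
      ({⟨b - 1 - l, y + 1, true⟩, ⟨b - 1 - l, y, false⟩} : Region) ∈ T := by
    intro l
    induction l with
    | zero =>
      intro y h
      have hm := staircases_subset_hexagon hab hac
        (Finset.mem_union_right _ ((down_mem_eastStaircase hac).2 h))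
      obtain ⟨t, ht, htT⟩ := hT.exists_adjacent hm
      rw [Finset.pair_comm] at htT
      rcases adjacent_down_iff.1 ht with rfl | rfl | rfl
      · exact absurd (cutWeight_of_forbidden (forbidden_beta.2 h)) (hw _ htT)
      · exact htT
      · have := hT.subset htT (Finset.mem_insert_self _ _)
        rw [up_mem_hexagon] at this
        omega
    | succ l ih =>
      intro y h
      have hm := staircases_subset_hexagon hab hac
        (Finset.mem_union_right _ ((down_mem_eastStaircase hac).2 h))
      obtain ⟨t, ht, htT⟩ := hT.exists_adjacent hm
      rw [Finset.pair_comm] at htT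
      rcases adjacent_down_iff.1 ht with rfl | rfl | rfl
      · exact absurd (cutWeight_of_forbidden (forbidden_beta.2 h)) (hw _ htT)
      · exact htT
      · have h1 := ih (y - 1) (by rw [InEast] at h ⊢; omega)
        have h2 := hT.eq_of_mem htT h1 (t := ⟨b - 1 - l, y, true⟩)
          (by simp; omega) (by simp)
        rw [updown_eq_updown] at h2
        omega
  intro l hl
  obtain ⟨x, y, h, rfl⟩ := mem_eastTiles.1 hl
  have hx : x = b - 1 - ((b - 1 - x).toNat : ℕ) := by rw [InEast] at h; omega
  rw [hx] at h ⊢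
  exact key _ y h

theorem IsLozengeTiling.sdiff {R Q : Region} {T S : Finset Region} (hT : IsLozengeTiling R T)
    (hS : IsLozengeTiling Q S) (hST : S ⊆ T) : IsLozengeTiling (R \ Q) (T \ S) := by
  refine ⟨fun m hm => hT.1 m (Finset.mem_sdiff.1 hm).1, hT.2.1.subset (by simp), ?_⟩
  ext t
  simp only [Finset.mem_biUnion, Finset.mem_sdiff, id]
  constructor
  · rintro ⟨m, ⟨hm, hmS⟩, ht⟩
    refine ⟨hT.subset hm ht, fun h => hmS ?_⟩
    rw [← hS.2.2, Finset.mem_biUnion] at h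
    obtain ⟨l, hl, htl⟩ := h
    rwa [hT.eq_of_mem hm (hST hl) ht htl]
  · rintro ⟨ht, htQ⟩
    rw [← hT.2.2, Finset.mem_biUnion] at ht
    obtain ⟨m, hm, htm⟩ := ht
    exact ⟨m, ⟨hm, fun h => htQ (hS.subset h htm)⟩, htm⟩

theorem IsLozengeTiling.disjoint {R Q : Region} {T S : Finset Region} (hT : IsLozengeTiling R T)
    (hS : IsLozengeTiling Q S) (h : Disjoint R Q) : Disjoint T S := by
  rw [Finset.disjoint_left]
  intro l hl hl'
  obtain ⟨s, t, -, rfl⟩ := hT.1 l hl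
  exact Finset.disjoint_left.1 h (hT.subset hl (Finset.mem_insert_self _ _))
    (hS.subset hl' (Finset.mem_insert_self _ _))

theorem prod_cutWeight_staircases {a b c : ℕ} (hab : a ≤ b) (hac : a ≤ c) :
    ∏ l ∈ nwTiles a c ∪ eastTiles a b, cutWeight a b c l = 1 := by
  refine Finset.prod_eq_one fun l hl => ?_
  rcases Finset.mem_union.1 hl with hl | hl
  · obtain ⟨x, y, h, rfl⟩ := mem_nwTiles.1 hl
    rw [cutWeight_beta hab, if_neg, if_neg]
    · rw [InNW] at h; rw [OnNWCut]; omega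
    · rw [InNW] at h; rw [InEast]; omega
  · obtain ⟨x, y, h, rfl⟩ := mem_eastTiles.1 hl
    have := cutWeight_gamma (a := a) (b := b) (c := c) hab x (y + 1)
    rw [add_sub_cancel_right] at this
    rw [this, if_neg]
    rw [InEast] at h; rw [InNW]; omega

theorem prod_cutWeight {a b c : ℕ} (hab : a ≤ b) (hac : a ≤ c) {T : Finset Region}
    (hT : IsLozengeTiling (cutHexagon a b c) T) :
    ∏ l ∈ T, cutWeight a b c l = (1 / 2 : ℚ) ^ (T ∩ nwCutPositions a b c).card := by
  classical
  have h : ∀ l ∈ T, cutWeight a b c l = if l ∈ nwCutPositions a b c then 1 / 2 else 1 := by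
    intro l hl
    rw [cutWeight, if_neg]
    rintro (⟨x, y, h, rfl⟩ | ⟨x, y, h, rfl⟩)
    · have := hT.subset hl (Finset.mem_insert_self _ _)
      rw [cutHexagon, Finset.mem_sdiff, Finset.mem_union, up_mem_nwStaircase hab] at this
      exact this.2 (Or.inl h)
    · have := hT.subset hl (Finset.mem_insert_of_mem (Finset.mem_singleton_self _))
      rw [cutHexagon, Finset.mem_sdiff, Finset.mem_union, down_mem_eastStaircase hac] at this
      exact this.2 (Or.inr h)
  rw [Finset.prod_congr rfl h, Finset.prod_ite, Finset.prod_const, Finset.prod_const_one, mul_one,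
    Finset.filter_mem_eq_inter]

/-- A tiling of nonzero weight contains the two staircase tilings, which have weight `1`. Removing
or adding them is a weight-preserving bijection. -/
theorem upperStarCount_eq_tilingSum {a b c : ℕ} (hab : a ≤ b) (hac : a ≤ c) :
    upperStarCount a b c = tilingSum (cutWeight a b c) (hexagon a b c) := by
  classical
  have hS := isLozengeTiling_staircases hab hac
  set S := nwTiles a c ∪ eastTiles a b with hSdef
  have hsub := staircases_subset_hexagon hab hac
  have hdis : Disjoint (cutHexagon a b c) (nwStaircase a b c ∪ eastStaircase a b c) :=
    Finset.sdiff_disjoint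
  have hfilter : tilingSum (cutWeight a b c) (hexagon a b c) =
      ∑ T ∈ (tilings (hexagon a b c)).filter (S ⊆ ·), ∏ l ∈ T, cutWeight a b c l := by
    rw [tilingSum, Finset.sum_filter_of_ne]
    intro T hT h
    have hw : ∀ l ∈ T, cutWeight a b c l ≠ 0 := Finset.prod_ne_zero_iff.1 h
    exact Finset.union_subset (nwTiles_subset hab hac (mem_tilings.1 hT) hw)
      (eastTiles_subset hab hac (mem_tilings.1 hT) hw)
  rw [hfilter, upperStarCount, weightedCount]
  refine Finset.sum_nbij' (fun T => T ∪ S) (fun T => T \ S) ?_ ?_ ?_ ?_ ?_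
  · intro T hT
    have := (mem_tilings.1 hT).union hS hdis
    rw [cutHexagon, Finset.sdiff_union_of_subset hsub] at this
    exact Finset.mem_filter.2 ⟨mem_tilings.2 this, Finset.subset_union_right⟩
  · intro T hT
    obtain ⟨h1, h2⟩ := Finset.mem_filter.1 hT
    exact mem_tilings.2 ((mem_tilings.1 h1).sdiff hS h2)
  · intro T hT
    exact Finset.union_sdiff_cancel_right ((mem_tilings.1 hT).disjoint hS hdis)
  · intro T hT
    exact Finset.sdiff_union_of_subset (Finset.mem_filter.1 hT).2
  · intro T hT
    rw [Finset.prod_union ((mem_tilings.1 hT).disjoint hS hdis), hSdef,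
      prod_cutWeight_staircases hab hac, mul_one, prod_cutWeight hab hac (mem_tilings.1 hT)]

/-! ### Path sums in closed form and reduction to the factorial matrix -/

open scoped Nat

/-- The binomial coefficient with an integer lower entry. -/
def intChoose (m : ℕ) (z : ℤ) : ℚ := if z < 0 then 0 else m.choose z.toNat

theorem intChoose_zero (z : ℤ) : intChoose 0 z = if z = 0 then 1 else 0 := by
  rcases lt_trichotomy z 0 with h | rfl | h
  · rw [intChoose, if_pos h, if_neg h.ne]
  · simp [intChoose]
  · rw [intChoose, if_neg (by omega), if_neg h.ne', Nat.choose_eq_zero_of_lt (by omega)]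
    simp

theorem intChoose_eq_zero_of_lt {m : ℕ} {z : ℤ} (h : m < z) : intChoose m z = 0 := by
  rw [intChoose, if_neg (by omega), Nat.choose_eq_zero_of_lt (by omega)]
  simp

theorem intChoose_succ (m : ℕ) (z : ℤ) :
    intChoose (m + 1) z = intChoose m z + intChoose m (z - 1) := by
  rcases lt_trichotomy z 0 with h | rfl | h
  · rw [intChoose, intChoose, intChoose, if_pos h, if_pos h, if_pos (by omega), add_zero]
  · simp [intChoose]
  · obtain ⟨k, rfl⟩ : ∃ k : ℕ, z = k + 1 := ⟨(z - 1).toNat, by omega⟩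
    rw [intChoose, intChoose, intChoose, if_neg (by omega), if_neg (by omega), if_neg (by omega),
      add_sub_cancel_right, Int.toNat_natCast, show ((k : ℤ) + 1).toNat = k + 1 by omega,
      Nat.choose_succ_succ, Nat.cast_add, add_comm]

theorem invFactorial_sub_one (z : ℤ) : invFactorial (z - 1) = z * invFactorial z := by
  rcases lt_trichotomy z 0 with h | rfl | h
  · rw [invFactorial_of_neg h, invFactorial_of_neg (by omega), mul_zero]
  · rw [invFactorial_of_neg (by omega)]; simp
  · obtain ⟨k, rfl⟩ : ∃ k : ℕ, z = k + 1 := ⟨(z - 1).toNat, by omega⟩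
    have h : invFactorial ((k : ℤ) + 1) = ((k + 1)! : ℚ)⁻¹ := invFactorial_natCast (k + 1)
    rw [add_sub_cancel_right, invFactorial_natCast, h, Nat.factorial_succ]
    push_cast
    have : (k ! : ℚ) ≠ 0 := by positivity
    have : (k : ℚ) + 1 ≠ 0 := by positivity
    field_simp

theorem intChoose_eq (m : ℕ) (z : ℤ) :
    intChoose m z = m ! * invFactorial z * invFactorial (m - z) := by
  rcases lt_or_ge z 0 with h | h
  · rw [intChoose, if_pos h, invFactorial_of_neg h]; simp
  obtain ⟨k, rfl⟩ := Int.eq_ofNat_of_zero_le h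
  rcases lt_or_ge m k with h' | h'
  · rw [intChoose_eq_zero_of_lt (by omega), invFactorial_of_neg (z := m - k) (by omega), mul_zero]
  · rw [intChoose, if_neg (by omega), Int.toNat_natCast, ← Nat.cast_sub h', invFactorial_natCast,
      invFactorial_natCast, Nat.cast_choose ℚ h']
    field_simp

/-- The two terms are `β/2` and `γ` times `p!/(β! γ!)`. They come from the level and the descending
step across the northwestern cut. -/
theorem half_intChoose_add (p : ℕ) (β γ : ℤ) (h : β + γ = p + 1) :
    1 / 2 * intChoose p γ + intChoose p (γ - 1) =
      (β + 2 * γ) / 2 * (p ! * invFactorial β * invFactorial γ) := by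
  rw [intChoose_eq, intChoose_eq, show (p : ℤ) - γ = β - 1 by omega,
    show (p : ℤ) - (γ - 1) = β by omega, invFactorial_sub_one, invFactorial_sub_one]
  ring

/-- The bound on `y` says that the path is strictly below the cut, so only the eastern weights
matter. They force the last `j` steps to descend, from ordinate `2 * j` at abscissa `b - j`; the
first `n - j` steps are free and include `y - 2 * j` descents. If `n < j`, all steps descend. -/
theorem pathSum_cutWeight {a b c : ℕ} (hab : a ≤ b) {n : ℕ} {y : ℤ}
    (hy : y < b - n + 2 * c) {j : ℕ} (hj : j < a) :
    pathSum (cutWeight a b c) b n y j =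
      if j ≤ n then intChoose (n - j) (y - 2 * j) else if y = j + n then 1 else 0 := by
  classical
  induction n generalizing y with
  | zero =>
    rw [pathSum]
    rcases Nat.eq_zero_or_pos j with rfl | hj0
    · simp [intChoose_zero]
    · simp [hj0.ne']
  | succ n ih =>
    push_cast at hy
    rw [pathSum, cutWeight_beta hab, cutWeight_gamma hab, ih (by omega), ih (by omega),
      if_neg (c := InNW _ _ _ _) (by rw [InNW]; omega),
      if_neg (c := OnNWCut _ _ _ _) (by rw [OnNWCut]; omega), one_mul]
    rcases le_or_gt j n with hjn | hjn
    · rw [if_pos hjn, if_pos hjn, if_pos (c := j ≤ n + 1) (by omega),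
        show n + 1 - j = (n - j) + 1 by omega, intChoose_succ,
        show y - 1 - 2 * (j : ℤ) = y - 2 * j - 1 by ring]
      congr 1
      split_ifs with hE
      · rw [InEast] at hE
        rw [intChoose_eq_zero_of_lt (m := n - j) (by omega), mul_zero]
      · rw [one_mul]
    · have h1 : (if InEast a b ((b : ℤ) - n - 1) y then (0 : ℚ) else 1) *
          (if y = j + n then 1 else 0) = 0 := by
        rcases eq_or_ne y (j + n) with hy' | hy'
        · rw [if_pos (by rw [InEast]; omega), zero_mul]
        · rw [if_neg hy', mul_zero]
      rw [if_neg (c := j ≤ n) (by omega), if_neg (c := j ≤ n) (by omega), h1, zero_add]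
      have h2 : y - 1 = j + n ↔ y = j + (n + 1 : ℕ) := by push_cast; omega
      simp only [h2]
      rcases le_or_gt j (n + 1) with h3 | h3
      · obtain rfl : j = n + 1 := by omega
        rw [if_pos le_rfl, Nat.sub_self, intChoose_zero]
        congr 1
        exact propext (by push_cast; omega)
      · rw [if_neg (c := j ≤ n + 1) (by omega)]

theorem pathSum_start {a b c : ℕ} (hab : a ≤ b) (hac : a ≤ c) {i j : ℕ} (hi : i < a) (hj : j < a) :
    pathSum (cutWeight a b c) b (b + c) (c + i) j =
      1 / 2 * intChoose (b + c - i - 1 - j) (c + i - 2 * j) +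
        intChoose (b + c - i - 1 - j) (c + i - 2 * j - 1) := by
  -- The first `i` steps lie in the northwestern staircase, where descending has weight zero. The
  -- next one crosses the cut.
  have h1 : ∀ k : ℕ, k ≤ i → pathSum (cutWeight a b c) b (b + c) (c + i) j =
      pathSum (cutWeight a b c) b (b + c - k) (c + i) j := by
    intro k hk
    induction k with
    | zero => rfl
    | succ k ih =>
      rw [ih (by omega), show b + c - k = (b + c - (k + 1)) + 1 by omega, pathSum,
        cutWeight_beta hab, cutWeight_gamma hab,
        if_pos (c := InNW _ _ _ _) (by rw [InNW]; omega),
        if_neg (c := OnNWCut _ _ _ _) (by rw [OnNWCut]; omega),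
        if_neg (c := InEast _ _ _ _) (by rw [InEast]; omega)]
      ring
  rw [h1 i le_rfl, show b + c - i = (b + c - i - 1) + 1 by omega, pathSum,
    cutWeight_beta hab, cutWeight_gamma hab,
    if_neg (c := InNW _ _ _ _) (by rw [InNW]; omega),
    if_pos (c := OnNWCut _ _ _ _) (by rw [OnNWCut]; omega),
    if_neg (c := InEast _ _ _ _) (by rw [InEast]; omega),
    pathSum_cutWeight hab (by omega) hj, pathSum_cutWeight hab (by omega) hj,
    if_pos (by omega), if_pos (by omega), one_mul]
  congr 2
  ring

theorem upperStarCount_eq_det {a b c : ℕ} (hab : a ≤ b) (hac : a ≤ c) :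
    upperStarCount a b c = (∏ k : Fin a, ((b : ℚ) + 2 * c - 3 * a + 3 + 3 * (k : ℕ)) / 2) *
      (factorialMatrix a (b + c + 1 - 2 * a) (b - a + 1) (c - a + 1)).det := by
  -- The column factors are absorbed into the determinant on the right. Reversing both indices on
  -- the left makes the numerator `(p + l + k)!` grow with them.
  rw [upperStarCount_eq_tilingSum hab hac, tilingSum_hexagon _ (cutWeight_horizontal hab),
    ← Matrix.det_mul_row, ← Matrix.det_submatrix_equiv_self Fin.revPerm]
  congr 1
  ext l k
  have hl := l.2
  have hk := k.2
  rw [Matrix.submatrix_apply, Matrix.of_apply, Matrix.of_apply, Fin.revPerm_apply,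
    Fin.revPerm_apply, pathSum_start hab hac (Fin.rev l).2 (Fin.rev k).2, Fin.val_rev, Fin.val_rev,
    half_intChoose_add _ ((b : ℤ) - a + 1 + 2 * (l : ℕ) - (k : ℕ)) _ (by omega),
    factorialMatrix, Matrix.of_apply,
    show b + c - (a - (l + 1)) - 1 - (a - (k + 1)) = b + c + 1 - 2 * a + l + k by omega,
    show (c : ℤ) + (a - (l + 1) : ℕ) - 2 * (a - (k + 1) : ℕ) = c - a + 1 + 2 * (k : ℕ) - (l : ℕ)
      by omega]
  congr 1
  push_cast
  ring

end TriLattice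

theorem proposition1p3 (a b c : ℕ) (hab : a ≤ b) (hbc : b ≤ c) :
    TriLattice.upperStarCount a b c =
      1 / 2 ^ a * ∏ j ∈ Finset.Icc 1 a,
        (((j - 1).factorial : ℚ) * ((b : ℚ) + 2 * c - 3 * a + 3 * j) *
            ((b + c + j - 2 * a).factorial : ℚ) / ((c + 2 * j - 1 - a).factorial : ℚ) *
          ((ascPochhammer ℚ (j - 1)).eval ((b : ℚ) + 2 * c - 3 * a + 2 * j + 1) *
              (ascPochhammer ℚ (j - 1)).eval (2 * (b : ℚ) + c - 3 * a + 2 * j + 1) /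
            ((b + 2 * j - 1 - a).factorial : ℚ))) := by
  rw [TriLattice.upperStarCount_eq_det hab (hab.trans hbc)]
  obtain ⟨x, rfl⟩ := Nat.exists_eq_add_of_le hab
  obtain ⟨y, rfl⟩ := Nat.exists_eq_add_of_le (hab.trans hbc)
  -- With `b = a + x` and `c = a + y`, the parameters `b - a + 1`, `c - a + 1` and `b + c + 1 - 2a`
  -- satisfy the relation required by the evaluation.
  have h := det_factorialMatrix a (x + y + 1) (x + 1) (y + 1) (by ring)
  rw [show a + x + (a + y) + 1 - 2 * a = x + y + 1 by omega,
    show ((a + x : ℕ) : ℤ) - a + 1 = (x + 1 : ℕ) by push_cast; ring,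
    show ((a + y : ℕ) : ℤ) - a + 1 = (y + 1 : ℕ) by push_cast; ring, h, factorialProduct,
    Fin.prod_univ_eq_prod_range
      (fun k => (((a + x : ℕ) : ℚ) + 2 * (a + y : ℕ) - 3 * a + 3 + 3 * k) / 2) a,
    ← Finset.prod_mul_distrib, ← Finset.Ico_add_one_right_eq_Icc, Finset.prod_Ico_eq_prod_range,
    Nat.add_sub_cancel, ← one_div_pow, ← Finset.card_range a, ← Finset.prod_const,
    Finset.card_range, ← Finset.prod_mul_distrib]
  refine Finset.prod_congr rfl fun i _ => ?_
  rw [show 1 + i - 1 = i by omega, show a + x + (a + y) + (1 + i) - 2 * a = x + y + 1 + i by omega,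
    show a + y + 2 * (1 + i) - 1 - a = y + 1 + 2 * i by omega,
    show a + x + 2 * (1 + i) - 1 - a = x + 1 + 2 * i by omega,
    show ((a + x : ℕ) : ℚ) + 2 * (a + y : ℕ) - 3 * a + 2 * (1 + i : ℕ) + 1 =
      ((x + 1 : ℕ) : ℚ) + 2 * (y + 1 : ℕ) + 2 * i by push_cast; ring,
    show 2 * ((a + x : ℕ) : ℚ) + (a + y : ℕ) - 3 * a + 2 * (1 + i : ℕ) + 1 =
      2 * ((x + 1 : ℕ) : ℚ) + (y + 1 : ℕ) + 2 * i by push_cast; ring]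
  push_cast
  field_simp
  ring
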